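/- **Conventions.** Let $\mathcal V$ be a finite-dimensional real vector space with a symmetric positive semidefinite bilinear form $(\cdot,\cdot)\neq 0$, and let $\mathcal V^0$ be its radical. For $R\subseteq\mathcal V$ write $\langle R\rangle$ for the additive subgroup generated by $R$, $R^0=R\cap\mathcal V^0$ and $R^\times=R\setminus R^0$. For $\alpha$ with $(\alpha,\alpha)\ne0$ put $\alpha^\vee=2\alpha/(\alpha,\alpha)$ and $w_\alpha(\beta)=\beta-(\beta,\alpha^\vee)\alpha$. $R$ is an *extended affine root system* (EARS) in $\mathcal V$ if: (R1) $\langle R\rangle$ is a full lattice in $\mathcal V$ (the $\mathbb Z$-span of an $\mathbb R$-basis); (R2) $(\beta,\alpha^\vee)\in\mathbb Z$ for $\alpha,\beta\in R^\times$; (R3) $w_\alpha(\beta)\in R$ for $\alpha\in R^\times$, $\beta\in R$; (R4) $R^0=\mathcal V^0\cap(R^\times-R^\times)$; (R5) $2\alpha\notin R$ for $\alpha\in R^\times$. It is *irreducible* if $R^\times$ is not the union of two non-empty mutually orthogonal subsets, and *reduced* if its image in $\mathcal V/\mathcal V^0$ is a reduced root system, i.e. the only non-zero multiples of a non-zero element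 $x$ of the image that lie in the image are $\pm x$. A subset $T\subseteq R$ is a *subsystem* of $R$ if $T$ is an EARS in $\operatorname{span}_{\mathbb R}T$ for the restricted form; irreducibility of $T$ is understood there. The subsystem $T$ is *finite* if it is a finite set. It is *affine* if, in $\operatorname{span}_{\mathbb R}T$ with the restricted form, it is the root system (including $0$) of an affine Kac–Moody algebra, i.e. if $\operatorname{span}_{\mathbb R}T$ has a basis $\alpha_1,\dots,\alpha_n$ with $(\alpha_i,\alpha_i)>0$ such that * $A=\big((\alpha_j,\alpha_i^\vee)\big)_{i,j}$ is an indecomposable generalized Cartan matrix of affine type, that is, an indecomposable generalized Cartan matrix with $Au=0$ for a (unique) vector $u$ of positive integers with greatest common divisor $1$; * $T^\times=\{w(\alpha_i)\mid w\in W,\ 1\le i\le n\}$, where $W$ is the group generated by $w_{\alpha_1},\dots,w_{\alpha_n}$; * $T^0=\mathbb Z\delta$, where $\delta=\sum_i u_i\alpha_i$. **Proposition.** Let $R$ be an irreducible reduced EARS in $\mathcal V$, let $T$ be a finite irreducible subsystem of $R$, and let $0\neq\lambda\in\Lambda:=\langle R^0\rangle$. Put $$T_\lambda:=(T^\times+\mathbb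 Z\lambda)\cap R,\qquad R_{T,\lambda}:=T_\lambda\cup\big((T_\lambda-T_\lambda)\cap R^0\big).$$ Then $R_{T,\lambda}$ is an affine irreducible subsystem of $R$: it is a subset of $R$, it is an irreducible EARS in its real span with respect to the restricted form, and it is an affine root system there. -/

import Mathlib

open scoped Matrix

namespace ExtAffine

section Forms

variable {V : Type*} [AddCommGroup V] [Module ℝ V]

/-- The radical `V⁰` of a symmetric bilinear form. -/
def radical (B : LinearMap.BilinForm ℝ V) : Submodule ℝ V := LinearMap.ker B

/-- The isotropic part `R⁰ = R ∩ V⁰`. -/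
def iso (B : LinearMap.BilinForm ℝ V) (R : Set V) : Set V := R ∩ (radical B : Set V)

/-- The non-isotropic part `R^× = R \ R⁰`. -/
def nonIso (B : LinearMap.BilinForm ℝ V) (R : Set V) : Set V := R \ iso B R

/-- The number `(β, α^∨)`, where `α^∨ = 2α / (α, α)`. -/
noncomputable def pairing (B : LinearMap.BilinForm ℝ V) (β α : V) : ℝ :=
  2 * B β α / B α α

/-- The reflection `w_α (β) = β - (β, α^∨) α` (meaningful for `(α, α) ≠ 0`). -/
noncomputable def refl (B : LinearMap.BilinForm ℝ V) (α β : V) : V :=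
  β - pairing B β α • α

/-- Extended affine root systems `(V, (·,·), R)`. Finite-dimensionality of `V` is a consequence of
`full_lattice`: the subgroup `⟨R⟩` generated by `R` is the `ℤ`-span of a finite `ℝ`-basis of `V`. -/
structure IsEARS (B : LinearMap.BilinForm ℝ V) (R : Set V) : Prop where
  symm : ∀ v w, B v w = B w v
  posSemidef : ∀ v, 0 ≤ B v v
  nontrivial : B ≠ 0
  full_lattice : ∃ (n : ℕ) (b : Module.Basis (Fin n) ℝ V),
    AddSubgroup.closure R = AddSubgroup.closure (Set.range b)
  integral : ∀ α ∈ nonIso B R, ∀ β ∈ nonIso B R, ∃ k : ℤ, pairing B β α = k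
  refl_mem : ∀ α ∈ nonIso B R, ∀ β ∈ R, refl B α β ∈ R
  iso_eq : iso B R = {σ | σ ∈ radical B ∧ ∃ α ∈ nonIso B R, ∃ β ∈ nonIso B R, σ = α - β}
  two_smul_notMem : ∀ α ∈ nonIso B R, (2 : ℝ) • α ∉ R

/-- `R` is irreducible: `R^×` is not the union of two non-empty orthogonal subsets. -/
def IsIrreducible (B : LinearMap.BilinForm ℝ V) (R : Set V) : Prop :=
  ¬ ∃ P Q : Set V, P.Nonempty ∧ Q.Nonempty ∧ P ∪ Q = nonIso B R ∧
    ∀ α ∈ P, ∀ β ∈ Q, B α β = 0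

/-- The image of `R` in `V / V⁰`. -/
def barR (B : LinearMap.BilinForm ℝ V) (R : Set V) : Set (V ⧸ radical B) :=
  (radical B).mkQ '' R

/-- `R` is reduced: the finite root system obtained as the image of `R` in `V / V⁰` is reduced,
i.e. the only non-zero multiples of a root that are roots are plus or minus that root. -/
def IsReduced (B : LinearMap.BilinForm ℝ V) (R : Set V) : Prop :=
  ∀ x ∈ barR B R, x ≠ 0 → ∀ c : ℝ, c ≠ 0 → c • x ∈ barR B R → c = 1 ∨ c = -1

/-- The lattice `Λ = ⟨R⁰⟩`. -/
def isoLattice (B : LinearMap.BilinForm ℝ V) (R : Set V) : AddSubgroup V :=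
  AddSubgroup.closure (iso B R)

/-- The form induced on `V_T = span_ℝ T`. -/
def inducedForm (B : LinearMap.BilinForm ℝ V) (T : Set V) :
    LinearMap.BilinForm ℝ (Submodule.span ℝ T) :=
  B.restrict (Submodule.span ℝ T)

/-- `T`, viewed as a subset of `V_T = span_ℝ T`. -/
def inSpan (T : Set V) : Set (Submodule.span ℝ T) := Subtype.val ⁻¹' T

/-- `T` is a subsystem of `R`. -/
def IsSubsystem (B : LinearMap.BilinForm ℝ V) (R T : Set V) : Prop :=
  T ⊆ R ∧ IsEARS (inducedForm B T) (inSpan T)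

/-- `T` is irreducible as a root system in its own span. -/
def IsIrreducibleSub (B : LinearMap.BilinForm ℝ V) (T : Set V) : Prop :=
  IsIrreducible (inducedForm B T) (inSpan T)

end Forms

section CartanMatrices

variable {ι : Type*} [Fintype ι]

/-- Generalized Cartan matrices. -/
structure IsGCM (A : Matrix ι ι ℤ) : Prop where
  diag : ∀ i, A i i = 2
  nonpos : ∀ i j, i ≠ j → A i j ≤ 0
  zero_symm : ∀ i j, A i j = 0 → A j i = 0

/-- The index set cannot be split into two non-empty parts between which `A` vanishes. -/
def IsIndecomposable (A : Matrix ι ι ℤ) : Prop :=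
  ∀ s : Set ι, s.Nonempty → sᶜ.Nonempty → ∃ i ∈ s, ∃ j ∈ sᶜ, A i j ≠ 0

/-- `u` is a positive integral vector with `A u = 0` whose entries have no common divisor.
An indecomposable generalized Cartan matrix is of affine type exactly if it has such a vector, which
is then unique; its entries are the marks (Kac labels). -/
structure IsMarks (A : Matrix ι ι ℤ) (u : ι → ℤ) : Prop where
  pos : ∀ i, 0 < u i
  null : A *ᵥ u = 0
  coprime : ∀ d : ℤ, (∀ i, d ∣ u i) → IsUnit d

end CartanMatrices

section Affine

variable {V : Type*} [AddCommGroup V] [Module ℝ V]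

/-- The group generated by the reflections in the vectors `a i`. -/
def weylGroup (B : LinearMap.BilinForm ℝ V) {ι : Type*} (a : ι → V) : Subgroup (V ≃ₗ[ℝ] V) :=
  Subgroup.closure {g | ∃ i, ∀ v, g v = refl B (a i) v}

/-- `R` is an affine root system in `V`, i.e. the root system (with `0`) of an affine Kac-Moody
algebra: there is a basis `a` of `V` (the simple roots), whose Cartan matrix is an indecomposable
generalized Cartan matrix of affine type, such that the non-isotropic (real) roots are the
images of simple roots under the Weyl group, and the isotropic roots (the imaginary ones and `0`)
are the integral multiples of the null root `δ = ∑ u i • a i`, where the `u i` are the marks. -/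
def IsAffine (B : LinearMap.BilinForm ℝ V) (R : Set V) : Prop :=
  ∃ (n : ℕ) (a : Module.Basis (Fin n) ℝ V) (A : Matrix (Fin n) (Fin n) ℤ) (u : Fin n → ℤ),
    (∀ i, 0 < B (a i) (a i)) ∧
    (∀ i j, (A i j : ℝ) = pairing B (a j) (a i)) ∧
    IsGCM A ∧ IsIndecomposable A ∧ IsMarks A u ∧
    nonIso B R = {β | ∃ w ∈ weylGroup B a, ∃ i, β = w (a i)} ∧
    iso B R = {σ | ∃ k : ℤ, σ = k • ∑ i, u i • a i}

/-- `T` is affine as a root system in its own span. -/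
def IsAffineSub (B : LinearMap.BilinForm ℝ V) (T : Set V) : Prop :=
  IsAffine (inducedForm B T) (inSpan T)

/-- `T_λ = (T^× + ℤ λ) ∩ R`. -/
def translates (B : LinearMap.BilinForm ℝ V) (R T : Set V) (l : V) : Set V :=
  {x | ∃ α ∈ nonIso B T, ∃ k : ℤ, x = α + k • l} ∩ R

/-- `R_{T,λ} = T_λ ∪ ((T_λ - T_λ) ∩ R⁰)`. -/
def affinization (B : LinearMap.BilinForm ℝ V) (R T : Set V) (l : V) : Set V :=
  translates B R T l ∪
    ({x | ∃ α ∈ translates B R T l, ∃ β ∈ translates B R T l, x = α - β} ∩ iso B R)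

end Affine

end ExtAffine

/-! The isotropic translates of a finite root `α` in the direction `λ` form an arithmetic
progression: `α + kλ` lies in `R` exactly when `m α ∣ k`, for a positive integer `m α`, the level of
`α`. Indeed the set of such `k` is closed under point reflections
(`exists_dvd_of_reflection_closed`), and irreducibility of `R` spreads non-trivial translates to all
roots (`IsEARS.exists_smul_isoLattice`). Since `w_{β+s} w_β` translates `α` by `(α, β^∨)s`, the
level is Weyl invariant and satisfies `m α ∣ (α, β^∨) m β` (`IsSubsystem.exists_isLevel`).

Finiteness of `T` and reducedness of `R` make `T^×` a finite irreducible reduced root system, with a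
base `a`. Among the roots of minimal level take a longest one that is dominant, `θ`, and put `δ =
m(θ)λ`. The simple roots of the affinization are `δ - θ` and the `a i`. Writing `θ = ∑ c i • a i`
with all `c i > 0` gives the marks: `1` for `δ - θ` and `c i` for `a i`.

The central claim is that the Weyl orbit of this extended base is exactly the set of admissible
translates (`simpleOrbit_extended_eq`). The extended Weyl group contains the translations `v ↦ v -
(v, (wθ)^∨)δ`. A root `α` that is not conjugate to `θ` is non-orthogonal to some conjugate `wθ`, and
`(α, (wθ)^∨) m(θ)` divides `m α` (`exists_conj_dvd_level`), so these translations reach every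
admissible translate of `α`. This is where both minimality of the level and maximality of the length
enter. Conjugates of `θ` are only moved by even multiples of `δ`; the odd multiples come from the
orbit of `δ - θ`. -/

namespace ExtAffine

/-! ### Semidefinite forms, Cartan numbers and reflections -/

section PSD

variable {V : Type*} [AddCommGroup V] [Module ℝ V] {B : LinearMap.BilinForm ℝ V}

/-- Symmetric positive semidefinite forms. -/
structure IsSymmPSD (B : LinearMap.BilinForm ℝ V) : Prop where
  symm : ∀ v w, B v w = B w v
  nonneg : ∀ v, 0 ≤ B v v

theorem IsSymmPSD.isSymm (hB : IsSymmPSD B) : LinearMap.IsSymm B :=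
  ⟨fun v w => by simpa using hB.symm v w⟩

theorem IsSymmPSD.mem_radical_iff (hB : IsSymmPSD B) {v : V} : v ∈ radical B ↔ B v v = 0 := by
  rw [LinearMap.BilinForm.apply_apply_same_eq_zero_iff B hB.nonneg hB.isSymm]
  rfl

theorem apply_of_mem_radical {v : V} (hv : v ∈ radical B) (w : V) : B v w = 0 := by
  have : B v = 0 := hv
  rw [this]; rfl

theorem IsSymmPSD.apply_right_of_mem_radical (hB : IsSymmPSD B) {v : V} (hv : v ∈ radical B)
    (w : V) : B w v = 0 := by
  rw [hB.symm, apply_of_mem_radical hv]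

theorem IsSymmPSD.pos_of_notMem (hB : IsSymmPSD B) {v : V} (hv : v ∉ radical B) : 0 < B v v :=
  lt_of_le_of_ne (hB.nonneg v) fun h => hv (hB.mem_radical_iff.2 h.symm)

theorem mem_nonIso {R : Set V} {v : V} : v ∈ nonIso B R ↔ v ∈ R ∧ v ∉ radical B := by
  simp only [nonIso, iso, Set.mem_sdiff, Set.mem_inter_iff, SetLike.mem_coe]
  tauto

theorem mem_iso {R : Set V} {v : V} : v ∈ iso B R ↔ v ∈ R ∧ v ∈ radical B := Iff.rfl

theorem pairing_self {v : V} (hv : B v v ≠ 0) : pairing B v v = 2 := by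
  rw [pairing]; field_simp

theorem pairing_add_left (v w a : V) : pairing B (v + w) a = pairing B v a + pairing B w a := by
  simp only [pairing, map_add, LinearMap.add_apply]; ring

theorem pairing_smul_left (c : ℝ) (v a : V) : pairing B (c • v) a = c * pairing B v a := by
  simp only [pairing, map_smul, LinearMap.smul_apply, smul_eq_mul]; ring

theorem pairing_neg_left (v a : V) : pairing B (-v) a = -pairing B v a := by
  simp only [pairing, map_neg, LinearMap.neg_apply]; ring

theorem pairing_neg_right (v a : V) : pairing B v (-a) = -pairing B v a := by
  simp only [pairing, map_neg, LinearMap.neg_apply, neg_neg]; ring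

theorem pairing_add_radical_left {s : V} (hs : s ∈ radical B) (v a : V) :
    pairing B (v + s) a = pairing B v a := by
  simp [pairing, apply_of_mem_radical hs]

theorem IsSymmPSD.pairing_add_radical_right (hB : IsSymmPSD B) {s : V} (hs : s ∈ radical B)
    (v a : V) : pairing B v (a + s) = pairing B v a := by
  simp [pairing, apply_of_mem_radical hs, hB.apply_right_of_mem_radical hs]

theorem pairing_eq_zero_of_mem_radical {s : V} (hs : s ∈ radical B) (a : V) :
    pairing B s a = 0 := by
  simp [pairing, apply_of_mem_radical hs]

theorem refl_add (a v w : V) : refl B a (v + w) = refl B a v + refl B a w := by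
  simp only [refl, pairing_add_left, add_smul]; abel

theorem refl_self {a : V} (ha : B a a ≠ 0) : refl B a a = -a := by
  rw [refl, pairing_self ha, two_smul]; abel

theorem refl_of_mem_radical {s : V} (hs : s ∈ radical B) (a : V) : refl B a s = s := by
  simp [refl, pairing_eq_zero_of_mem_radical hs]

theorem refl_refl {a : V} (ha : B a a ≠ 0) (v : V) : refl B a (refl B a v) = v := by
  have h : pairing B (v - pairing B v a • a) a = -pairing B v a := by
    rw [sub_eq_add_neg, pairing_add_left, pairing_neg_left, pairing_smul_left, pairing_self ha]
    ring
  rw [refl, refl, h]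
  simp

/-- The reflection in a non-isotropic vector as a linear equivalence. -/
noncomputable def reflEquiv (B : LinearMap.BilinForm ℝ V) (a : V) (ha : B a a ≠ 0) : V ≃ₗ[ℝ] V :=
  Module.reflection (f := (2 / B a a) • LinearMap.flip B a) (x := a) (by
    simp only [LinearMap.smul_apply, LinearMap.flip_apply, smul_eq_mul]; field_simp)

theorem reflEquiv_apply {a : V} (ha : B a a ≠ 0) (v : V) : reflEquiv B a ha v = refl B a v := by
  simp only [reflEquiv, Module.reflection_apply, LinearMap.smul_apply, LinearMap.flip_apply,
    smul_eq_mul, refl, pairing]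
  congr 2
  ring

theorem IsSymmPSD.refl_isometry (hB : IsSymmPSD B) {a : V} (ha : B a a ≠ 0) (v w : V) :
    B (refl B a v) (refl B a w) = B v w := by
  simp only [refl, pairing, map_sub, LinearMap.sub_apply, map_smul, LinearMap.smul_apply,
    smul_eq_mul, hB.symm a w]
  field_simp
  ring

end PSD

/-! ### Weyl groups and orbits of simple vectors -/

section Weyl

variable {V : Type*} [AddCommGroup V] [Module ℝ V] {B : LinearMap.BilinForm ℝ V}
  {ι : Type*} {a : ι → V}

theorem reflEquiv_mem_weylGroup (i : ι) (hi : B (a i) (a i) ≠ 0) :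
    reflEquiv B (a i) hi ∈ weylGroup B a :=
  Subgroup.subset_closure ⟨i, fun v => reflEquiv_apply hi v⟩

/-- A set stable under the simple reflections is stable under the Weyl group. -/
theorem weylGroup_induction (ha : ∀ i, B (a i) (a i) ≠ 0) {p : V → Prop}
    (hp : ∀ i v, p v → p (refl B (a i) v)) {w : V ≃ₗ[ℝ] V} (hw : w ∈ weylGroup B a) {v : V}
    (hv : p v) : p (w v) := by
  have key : ∀ v, p v ↔ p (w v) := by
    induction hw using Subgroup.closure_induction with
    | mem g hg =>
      obtain ⟨i, hi⟩ := hg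
      intro v
      rw [hi]
      refine ⟨hp i v, fun h => ?_⟩
      simpa [refl_refl (ha i)] using hp i _ h
    | one => intro v; rfl
    | mul g h _ _ hg hh =>
      intro v
      rw [hh v, hg (h v)]
      rfl
    | inv g _ hg =>
      intro v
      rw [hg (g⁻¹ v)]
      simp
  exact (key v).1 hv

/-- The union of the Weyl group orbits of the `a i`. -/
def simpleOrbit (B : LinearMap.BilinForm ℝ V) (a : ι → V) : Set V :=
  {β | ∃ w ∈ weylGroup B a, ∃ i, β = w (a i)}

theorem apply_mem_simpleOrbit {w : V ≃ₗ[ℝ] V} (hw : w ∈ weylGroup B a) {v : V}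
    (hv : v ∈ simpleOrbit B a) : w v ∈ simpleOrbit B a := by
  obtain ⟨g, hg, i, rfl⟩ := hv
  exact ⟨w * g, mul_mem hw hg, i, rfl⟩

theorem self_mem_simpleOrbit (i : ι) : a i ∈ simpleOrbit B a := ⟨1, one_mem _, i, rfl⟩

theorem refl_mem_simpleOrbit (ha : ∀ i, B (a i) (a i) ≠ 0) (i : ι) {v : V}
    (hv : v ∈ simpleOrbit B a) : refl B (a i) v ∈ simpleOrbit B a := by
  rw [← reflEquiv_apply (ha i)]
  exact apply_mem_simpleOrbit (reflEquiv_mem_weylGroup i _) hv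

theorem simpleOrbit_induction (ha : ∀ i, B (a i) (a i) ≠ 0) {p : V → Prop}
    (h0 : ∀ i, p (a i)) (hp : ∀ i v, p v → p (refl B (a i) v)) {v : V}
    (hv : v ∈ simpleOrbit B a) : p v := by
  obtain ⟨w, hw, i, rfl⟩ := hv
  exact weylGroup_induction ha hp hw (h0 i)

theorem IsSymmPSD.weylGroup_isometry (hB : IsSymmPSD B) (ha : ∀ i, B (a i) (a i) ≠ 0)
    {w : V ≃ₗ[ℝ] V} (hw : w ∈ weylGroup B a) (x y : V) : B (w x) (w y) = B x y := by
  induction hw using Subgroup.closure_induction generalizing x y with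
  | mem g hg =>
    obtain ⟨i, hi⟩ := hg
    rw [hi, hi, hB.refl_isometry (ha i)]
  | one => rfl
  | mul g h _ _ hg hh => rw [LinearEquiv.mul_apply, LinearEquiv.mul_apply, hg, hh]
  | inv g _ hg =>
    rw [← hg]
    simp

theorem weylGroup_apply_of_mem_radical (ha : ∀ i, B (a i) (a i) ≠ 0)
    {w : V ≃ₗ[ℝ] V} (hw : w ∈ weylGroup B a) {s : V} (hs : s ∈ radical B) : w s = s :=
  weylGroup_induction (p := fun v => v = s) ha
    (fun i v hv => by rw [hv, refl_of_mem_radical hs]) hw rfl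

theorem IsSymmPSD.refl_weylGroup (hB : IsSymmPSD B) (ha : ∀ i, B (a i) (a i) ≠ 0)
    {w : V ≃ₗ[ℝ] V} (hw : w ∈ weylGroup B a) (b v : V) :
    refl B (w b) (w v) = w (refl B b v) := by
  simp only [refl, pairing, hB.weylGroup_isometry ha hw, map_sub, map_smul]

/-- Reflections in the orbit of the simple vectors belong to the Weyl group. -/
theorem IsSymmPSD.exists_weylGroup_eq_refl (hB : IsSymmPSD B) (ha : ∀ i, B (a i) (a i) ≠ 0)
    {b : V} (hb : b ∈ simpleOrbit B a) : ∃ g ∈ weylGroup B a, ∀ v, g v = refl B b v := by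
  obtain ⟨w, hw, i, rfl⟩ := hb
  refine ⟨w * reflEquiv B (a i) (ha i) * w⁻¹,
    mul_mem (mul_mem hw (reflEquiv_mem_weylGroup i _)) (inv_mem hw), fun v => ?_⟩
  have : v = w (w⁻¹ v) := by simp
  conv_rhs => rw [this]
  rw [hB.refl_weylGroup ha hw, ← reflEquiv_apply (ha i)]
  rfl

end Weyl

/-! ### Finite root systems and existence of a base -/

section FiniteRootSystems

variable {V : Type*} [AddCommGroup V] [Module ℝ V] {B : LinearMap.BilinForm ℝ V} {F : Set V}

/-- The non-isotropic part of a finite irreducible reduced root system that embeds in `V / V⁰`. -/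
structure IsFinRootSystem (B : LinearMap.BilinForm ℝ V) (F : Set V) : Prop where
  psd : IsSymmPSD B
  finite : F.Finite
  nonempty : F.Nonempty
  notMem_radical : ∀ α ∈ F, α ∉ radical B
  integral : ∀ α ∈ F, ∀ β ∈ F, ∃ k : ℤ, pairing B β α = k
  refl_mem : ∀ α ∈ F, ∀ β ∈ F, refl B α β ∈ F
  reduced : ∀ α ∈ F, ∀ β ∈ F, ∀ c : ℝ, α - c • β ∈ radical B → α = β ∨ α = -β
  irreducible : ∀ P Q : Set V, P.Nonempty → Q.Nonempty → P ∪ Q = F →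
    ∃ α ∈ P, ∃ β ∈ Q, B α β ≠ 0

namespace IsFinRootSystem

theorem pos (h : IsFinRootSystem B F) {α : V} (hα : α ∈ F) : 0 < B α α :=
  h.psd.pos_of_notMem (h.notMem_radical α hα)

theorem norm_ne (h : IsFinRootSystem B F) {α : V} (hα : α ∈ F) : B α α ≠ 0 := (h.pos hα).ne'

theorem neg_mem (h : IsFinRootSystem B F) {α : V} (hα : α ∈ F) : -α ∈ F := by
  rw [← refl_self (h.norm_ne hα)]
  exact h.refl_mem α hα α hα

/-- The strict Cauchy-Schwarz inequality for two non-proportional roots. -/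
theorem apply_sq_lt (h : IsFinRootSystem B F) {α β : V} (hα : α ∈ F) (hβ : β ∈ F)
    (h1 : α ≠ β) (h2 : α ≠ -β) : B α β ^ 2 < B α α * B β β := by
  by_contra! hcon
  have hβ0 := h.pos hβ
  -- Equality in Cauchy-Schwarz makes the component of `α` orthogonal to `β` isotropic, so `α` is a
  -- multiple of `β` modulo the radical and reducedness applies.
  have hmem : α - (B α β / B β β) • β ∈ radical B := by
    rw [h.psd.mem_radical_iff]
    refine le_antisymm ?_ (h.psd.nonneg _)
    have : B (α - (B α β / B β β) • β) (α - (B α β / B β β) • β)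
        = (B α α * B β β - B α β ^ 2) / B β β := by
      simp only [map_sub, LinearMap.sub_apply, map_smul, LinearMap.smul_apply, smul_eq_mul,
        h.psd.symm β α]
      field_simp
      ring
    rw [this]
    exact div_nonpos_of_nonpos_of_nonneg (by linarith) hβ0.le
  rcases h.reduced α hα β hβ _ hmem with h' | h'
  · exact h1 h'
  · exact h2 h'

/-- The product of the two Cartan integers of non-orthogonal, non-proportional roots. -/
theorem exists_pairing (h : IsFinRootSystem B F) {α β : V} (hα : α ∈ F) (hβ : β ∈ F)
    (h1 : α ≠ β) (h2 : α ≠ -β) (h0 : B α β ≠ 0) :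
    ∃ n n' : ℤ, pairing B α β = n ∧ pairing B β α = n' ∧ 0 < n * n' ∧ n * n' < 4 := by
  obtain ⟨n, hn⟩ := h.integral β hβ α hα
  obtain ⟨n', hn'⟩ := h.integral α hα β hβ
  have hα0 := h.pos hα
  have hβ0 := h.pos hβ
  have hlt := h.apply_sq_lt hα hβ h1 h2
  have hprod : ((n * n' : ℤ) : ℝ) = 4 * (B α β ^ 2 / (B α α * B β β)) := by
    push_cast
    rw [← hn, ← hn', pairing, pairing, h.psd.symm β α]
    field_simp
    ring
  have hpos : 0 < B α β ^ 2 / (B α α * B β β) := by positivity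
  have hlt' : B α β ^ 2 / (B α α * B β β) < 1 := (div_lt_one (by positivity)).2 hlt
  refine ⟨n, n', hn, hn', ?_, ?_⟩
  · exact_mod_cast (by rw [hprod]; linarith : (0 : ℝ) < ((n * n' : ℤ) : ℝ))
  · exact_mod_cast (by rw [hprod]; linarith : ((n * n' : ℤ) : ℝ) < (4 : ℤ))

/-- Both Cartan integers are positive and their product is at most `3`, so one of them is `1`; the
corresponding reflection yields `α - β` up to sign. -/
theorem sub_mem (h : IsFinRootSystem B F) {α β : V} (hα : α ∈ F) (hβ : β ∈ F)
    (h1 : α ≠ β) (h2 : α ≠ -β) (h0 : 0 < B α β) : α - β ∈ F := by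
  obtain ⟨n, n', hn, hn', hp, hlt⟩ := h.exists_pairing hα hβ h1 h2 h0.ne'
  have hnpos : 0 < n := by
    have : (0 : ℝ) < n := by
      rw [← hn, pairing]
      have := h.pos hβ
      positivity
    exact_mod_cast this
  have hn'pos : 0 < n' := pos_of_mul_pos_right hp hnpos.le
  rcases (by
    by_contra! hcon
    have h1 : 2 ≤ n := by omega
    have h2 : 2 ≤ n' := by omega
    nlinarith : n = 1 ∨ n' = 1) with e | e
  · have := h.refl_mem β hβ α hα
    rwa [refl, hn, e, Int.cast_one, one_smul] at this
  · have := h.neg_mem (h.refl_mem α hα β hβ)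
    rwa [refl, hn', e, Int.cast_one, one_smul, neg_sub] at this

end IsFinRootSystem

/-- A base (a system of simple roots) of a finite root system. -/
structure IsBase (B : LinearMap.BilinForm ℝ V) (F : Set V) {ι : Type*} [Fintype ι] (a : ι → V) :
    Prop where
  mem : ∀ i, a i ∈ F
  indep : LinearIndependent ℝ fun i => (radical B).mkQ (a i)
  nonpos : ∀ i j, i ≠ j → B (a i) (a j) ≤ 0
  combo : ∀ α ∈ F, (∃ c : ι → ℕ, α = ∑ i, c i • a i) ∨ ∃ c : ι → ℕ, -α = ∑ i, c i • a i

/-- Vectors at pairwise obtuse angles, positive under a functional that vanishes on the radical,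
are linearly independent modulo the radical. -/
theorem IsSymmPSD.linearIndependent_mkQ (hB : IsSymmPSD B) {ι : Type*} [Fintype ι] (a : ι → V)
    (f : V →ₗ[ℝ] ℝ) (hf : ∀ v ∈ radical B, f v = 0) (hpos : ∀ i, 0 < f (a i))
    (hn : ∀ i j, i ≠ j → B (a i) (a j) ≤ 0) :
    LinearIndependent ℝ fun i => (radical B).mkQ (a i) := by
  rw [Fintype.linearIndependent_iff]
  intro c hc
  have hc' : ∑ i, c i • a i ∈ radical B := by
    rw [← Submodule.Quotient.mk_eq_zero, ← Submodule.mkQ_apply, map_sum]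
    simpa using hc
  -- Splitting a relation into positive and negative parts gives `x ≡ y` modulo the radical with
  -- `(x, y) ≤ 0`, hence `(x, x) ≤ 0`. Thus both parts are isotropic, and positivity of `f` on the
  -- `a i` kills their coefficients.
  set x := ∑ i, (c i)⁺ • a i with hx
  set y := ∑ i, (c i)⁻ • a i with hy
  have hxy : x - y ∈ radical B := by
    rw [hx, hy, ← Finset.sum_sub_distrib]
    simpa only [← sub_smul, posPart_sub_negPart] using hc'
  have hle : B x y ≤ 0 := by
    rw [hx, hy]
    simp only [map_sum, LinearMap.sum_apply, map_smul, LinearMap.smul_apply, smul_eq_mul,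
      Finset.mul_sum]
    refine Finset.sum_nonpos fun i _ => Finset.sum_nonpos fun j _ => ?_
    rcases eq_or_ne j i with rfl | hji
    · rcases le_total 0 (c j) with h0 | h0
      · simp [negPart_eq_zero.2 h0]
      · simp [posPart_eq_zero.2 h0]
    · exact mul_nonpos_of_nonneg_of_nonpos (negPart_nonneg _)
        (mul_nonpos_of_nonneg_of_nonpos (posPart_nonneg _) (hn _ _ hji))
  have hxr : x ∈ radical B := by
    rw [hB.mem_radical_iff]
    have : B x x = B x y := by
      have := hB.apply_right_of_mem_radical hxy x
      rw [map_sub] at this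
      linarith
    exact le_antisymm (this ▸ hle) (hB.nonneg x)
  have hyr : y ∈ radical B := by
    have := (radical B).sub_mem hxr hxy
    rwa [sub_sub_cancel] at this
  have key : ∀ d : ι → ℝ, (∀ i, 0 ≤ d i) → ∑ i, d i • a i ∈ radical B → ∀ i, d i = 0 := by
    intro d hd hdr i
    have h0 := hf _ hdr
    simp only [map_sum, map_smul, smul_eq_mul] at h0
    rw [Finset.sum_eq_zero_iff_of_nonneg fun i _ => mul_nonneg (hd i) (hpos i).le] at h0
    exact (mul_eq_zero.1 (h0 i (Finset.mem_univ i))).resolve_right (hpos i).ne'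
  intro i
  have h1 := key _ (fun i => posPart_nonneg (c i)) hxr i
  have h2 := key _ (fun i => negPart_nonneg (c i)) hyr i
  rw [← posPart_sub_negPart (c i), h1, h2, sub_zero]

-- The base consists of the indecomposable roots on the positive side of a functional that vanishes
-- on the radical and on no root. An acute pair of them would have a root as its difference, which
-- would decompose one of the two.
open IsAddIndecomposable in
theorem IsFinRootSystem.exists_base (h : IsFinRootSystem B F) :
    ∃ (n : ℕ) (a : Fin n → V), IsBase B F a := by
  have : Finite F := h.finite
  obtain ⟨g, hg⟩ := Module.exists_dual_forall_apply_ne_zero (K := ℝ)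
    (fun x : F => (radical B).mkQ (x : V)) fun x hx => h.notMem_radical x x.2 (by
      rwa [Submodule.mkQ_apply, Submodule.Quotient.mk_eq_zero] at hx)
  let f : V →ₗ[ℝ] ℝ := g ∘ₗ (radical B).mkQ
  have hfrad : ∀ v ∈ radical B, f v = 0 := by
    intro v hv
    simp only [f, LinearMap.comp_apply, Submodule.mkQ_apply]
    rw [(Submodule.Quotient.mk_eq_zero _).2 hv, map_zero]
  have hf : ∀ x ∈ F, f x ≠ 0 := fun x hx => hg ⟨x, hx⟩
  let s : Set F := baseOf (Subtype.val : F → V) (f : V →+ ℝ)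
  obtain ⟨n, ⟨e⟩⟩ := Finite.exists_equiv_fin s
  let a : Fin n → V := fun i => ((e.symm i : F) : V)
  have ha : ∀ i, a i ∈ F := fun i => (e.symm i : F).2
  have hrange : Set.range a = Subtype.val '' s := by
    ext x
    constructor
    · rintro ⟨i, rfl⟩
      exact ⟨_, (e.symm i).2, rfl⟩
    · rintro ⟨y, hy, rfl⟩
      exact ⟨e ⟨y, hy⟩, by simp [a]⟩
  have hpos : ∀ i, 0 < f (a i) := fun i => (e.symm i).2.1
  have hcomb : ∀ α ∈ F, 0 < f α → ∃ c : Fin n → ℕ, α = ∑ i, c i • a i := by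
    intro α hα hα0
    have : α ∈ AddSubmonoid.closure (Set.range a) := by
      rw [hrange, AddSubmonoid.closure_image_isAddIndecomposable_baseOf]
      exact AddSubmonoid.subset_closure ⟨⟨α, hα⟩, hα0, rfl⟩
    obtain ⟨c, hc⟩ := AddSubmonoid.exists_of_mem_closure_range _ _ this
    exact ⟨c, hc⟩
  have hn : ∀ i j, i ≠ j → B (a i) (a j) ≤ 0 := by
    intro i j hij
    by_contra! hcon
    have hne : a i ≠ a j := fun hh => hij (e.symm.injective (Subtype.ext (Subtype.ext hh)))
    have hne' : a i ≠ -a j := by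
      intro hh
      have := hpos i
      rw [hh, map_neg] at this
      linarith [hpos j]
    have hsub := h.sub_mem (ha i) (ha j) hne hne' hcon
    have indec : ∀ i, ∀ x ∈ F, ∀ y ∈ F, 0 < f x → 0 < f y → a i ≠ x + y := by
      intro i x hx y hy hx0 hy0 hxy
      rcases (e.symm i).2.2 (j := ⟨x, hx⟩) hx0 (k := ⟨y, hy⟩) hy0 hxy with h' | h'
      · exact hf x hx (by rw [show x = 0 from h', map_zero])
      · exact hf y hy (by rw [show y = 0 from h', map_zero])
    rcases lt_or_gt_of_ne (hf _ hsub) with h' | h'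
    · refine indec j (a i) (ha i) _ (h.neg_mem hsub) (hpos i) ?_ (by abel)
      rw [map_neg]
      linarith
    · exact indec i (a j) (ha j) _ hsub (hpos j) h' (by abel)
  refine ⟨n, a, ha, h.psd.linearIndependent_mkQ a f hfrad hpos hn, hn, fun α hα => ?_⟩
  rcases lt_or_gt_of_ne (hf α hα) with h' | h'
  · exact Or.inr (hcomb _ (h.neg_mem hα) (by rw [map_neg]; linarith))
  · exact Or.inl (hcomb α hα h')

end FiniteRootSystems

/-! ### Consequences of having a base: conjugacy, indecomposability, dominant roots -/

section Bases

variable {V : Type*} [AddCommGroup V] [Module ℝ V] {B : LinearMap.BilinForm ℝ V} {F : Set V}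
  {ι : Type*} [Fintype ι] {a : ι → V}

namespace IsBase

theorem norm_ne (b : IsBase B F a) (h : IsFinRootSystem B F) (i : ι) : B (a i) (a i) ≠ 0 :=
  h.norm_ne (b.mem i)

theorem coeff_eq_zero (b : IsBase B F a) {c : ι → ℝ} (hc : ∑ i, c i • a i ∈ radical B) (i : ι) :
    c i = 0 := by
  refine Fintype.linearIndependent_iff.1 b.indep c ?_ i
  rw [← Submodule.Quotient.mk_eq_zero, ← Submodule.mkQ_apply, map_sum] at hc
  simpa using hc

theorem coeff_eq (b : IsBase B F a) {c d : ι → ℝ} (hc : ∑ i, c i • a i = ∑ i, d i • a i) (i : ι) :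
    c i = d i := by
  refine sub_eq_zero.1 (b.coeff_eq_zero (c := fun i => c i - d i) ?_ i)
  simp only [sub_smul, Finset.sum_sub_distrib, hc, sub_self, Submodule.zero_mem]

theorem exists_coeff (b : IsBase B F a) {α : V} (hα : α ∈ F) :
    (∃ c : ι → ℕ, α = ∑ i, (c i : ℝ) • a i) ∨ ∃ c : ι → ℕ, α = -∑ i, (c i : ℝ) • a i := by
  rcases b.combo α hα with ⟨c, hc⟩ | ⟨c, hc⟩
  · exact Or.inl ⟨c, by simpa only [Nat.cast_smul_eq_nsmul] using hc⟩
  · exact Or.inr ⟨c, by simp only [Nat.cast_smul_eq_nsmul, ← hc, neg_neg]⟩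

/-- Induction on the height `N`. As `(α, α) > 0`, some simple root in the support of `α` pairs
positively with it, and reflecting there lowers the height. -/
theorem mem_simpleOrbit_of_nonneg (b : IsBase B F a) (h : IsFinRootSystem B F) (N : ℕ) :
    ∀ α ∈ F, ∀ c : ι → ℕ, α = ∑ i, (c i : ℝ) • a i → ∑ i, c i = N → α ∈ simpleOrbit B a := by
  classical
  induction N using Nat.strong_induction_on with
  | _ N ih =>
  intro α hα c hc hN
  obtain ⟨i, hi⟩ : ∃ i, 0 < c i * B α (a i) := by
    by_contra! hcon
    have h1 : B α α = ∑ i, c i * B α (a i) := by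
      conv_lhs => rw [hc, map_sum, ← hc]
      simp only [map_smul, smul_eq_mul]
    have := h.pos hα
    rw [h1] at this
    exact absurd (Finset.sum_nonpos fun i _ => hcon i) (not_le.2 this)
  have hBi : 0 < B α (a i) := pos_of_mul_pos_right hi (Nat.cast_nonneg _)
  by_cases hne : α = a i
  · rw [hne]
    exact self_mem_simpleOrbit i
  have hne' : α ≠ -a i := by
    rintro rfl
    rw [map_neg, LinearMap.neg_apply] at hBi
    linarith [h.pos (b.mem i)]
  obtain ⟨n, hn⟩ := h.integral _ (b.mem i) _ hα
  have hnpos : (0 : ℝ) < n := by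
    rw [← hn, pairing]
    have := h.pos (b.mem i)
    positivity
  have hmem := h.refl_mem _ (b.mem i) _ hα
  have heq : refl B (a i) α = ∑ j, ((c j : ℝ) - if j = i then (n : ℝ) else 0) • a j := by
    simp only [sub_smul, Finset.sum_sub_distrib, ← hc, refl, hn, ite_smul, zero_smul,
      Finset.sum_ite_eq', Finset.mem_univ, if_true]
  rcases b.exists_coeff hmem with ⟨d, hd⟩ | ⟨d, hd⟩
  · have hcd := b.coeff_eq (heq.symm.trans hd)
    have hsum : ((∑ j, d j : ℕ) : ℝ) < (N : ℕ) := by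
      rw [← hN]
      push_cast
      simp only [← hcd, Finset.sum_sub_distrib, Finset.sum_ite_eq', Finset.mem_univ, if_true]
      linarith
    have := ih _ (by exact_mod_cast hsum) _ hmem d hd rfl
    rw [← refl_refl (b.norm_ne h i) α]
    exact refl_mem_simpleOrbit (b.norm_ne h) i this
  -- The reflection changes only the coefficient at `i`; a negative image would leave `α` supported
  -- on `a i` alone, and reducedness then forces `α = ±a i`.
  · exfalso
    rw [← Finset.sum_neg_distrib] at hd
    simp only [← neg_smul] at hd
    have hcd := b.coeff_eq (heq.symm.trans hd)
    have hc0 : ∀ j, j ≠ i → c j = 0 := by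
      intro j hj
      have := hcd j
      rw [if_neg hj, sub_zero] at this
      have h1 : (0 : ℝ) ≤ c j := Nat.cast_nonneg _
      have h2 : (0 : ℝ) ≤ d j := Nat.cast_nonneg _
      exact_mod_cast (by linarith : (c j : ℝ) = 0)
    have hαi : α = (c i : ℝ) • a i := by
      conv_lhs => rw [hc]
      refine Finset.sum_eq_single i (fun j _ hj => by simp [hc0 j hj]) (by simp)
    rcases h.reduced α hα _ (b.mem i) (c i) (by rw [← hαi, sub_self]; exact Submodule.zero_mem _)
      with h' | h'
    · exact hne h'
    · exact hne' h'

/-- Every root is conjugate to a simple root. -/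
theorem subset_simpleOrbit (b : IsBase B F a) (h : IsFinRootSystem B F) {α : V} (hα : α ∈ F) :
    α ∈ simpleOrbit B a := by
  rcases b.exists_coeff hα with ⟨c, hc⟩ | ⟨c, hc⟩
  · exact b.mem_simpleOrbit_of_nonneg h _ α hα c hc rfl
  · obtain ⟨w, hw, i, hi⟩ := b.mem_simpleOrbit_of_nonneg h _ (-α) (h.neg_mem hα) c
      (by rw [hc, neg_neg]) rfl
    have : α = w (refl B (a i) (a i)) := by
      rw [refl_self (b.norm_ne h i), map_neg, ← hi, neg_neg]
    rw [this]
    exact apply_mem_simpleOrbit hw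
      (refl_mem_simpleOrbit (b.norm_ne h) i (self_mem_simpleOrbit i))

/-- An orthogonal splitting of the base would split all roots: the union of the two orthogonal spans
is stable under the simple reflections, so it contains every orbit. -/
theorem exists_apply_ne_zero (b : IsBase B F a) (h : IsFinRootSystem B F) {s : Set ι}
    (hs : s.Nonempty) (hs' : sᶜ.Nonempty) : ∃ i ∈ s, ∃ j ∈ sᶜ, B (a i) (a j) ≠ 0 := by
  by_contra! hcon
  let S : Submodule ℝ V := Submodule.span ℝ (a '' s)
  let S' : Submodule ℝ V := Submodule.span ℝ (a '' sᶜ)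
  have horth : ∀ x ∈ S, ∀ y ∈ S', B x y = 0 := by
    intro x hx y hy
    induction hx using Submodule.span_induction with
    | mem x hx =>
      obtain ⟨i, hi, rfl⟩ := hx
      induction hy using Submodule.span_induction with
      | mem y hy =>
        obtain ⟨j, hj, rfl⟩ := hy
        exact hcon i hi j hj
      | zero => simp
      | add y z _ _ hy hz => rw [map_add, hy, hz, add_zero]
      | smul c y _ hy => rw [map_smul, hy, smul_zero]
    | zero => simp
    | add y z _ _ hy hz => rw [map_add, LinearMap.add_apply, hy, hz, add_zero]
    | smul c y _ hy => rw [map_smul, LinearMap.smul_apply, hy, smul_zero]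
  have hcover : ∀ α ∈ F, α ∈ S ∨ α ∈ S' := by
    intro α hα
    refine simpleOrbit_induction (p := fun v => v ∈ S ∨ v ∈ S') (b.norm_ne h) ?_ ?_
      (b.subset_simpleOrbit h hα)
    · intro i
      by_cases hi : i ∈ s
      · exact Or.inl (Submodule.subset_span ⟨i, hi, rfl⟩)
      · exact Or.inr (Submodule.subset_span ⟨i, hi, rfl⟩)
    · intro i v hv
      by_cases hi : i ∈ s
      · have hai : a i ∈ S := Submodule.subset_span ⟨i, hi, rfl⟩
        rcases hv with hv | hv
        · exact Or.inl (S.sub_mem hv (S.smul_mem _ hai))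
        · right
          rw [refl, pairing, h.psd.symm, horth _ hai _ hv]
          simpa using hv
      · have hai : a i ∈ S' := Submodule.subset_span ⟨i, hi, rfl⟩
        rcases hv with hv | hv
        · left
          rw [refl, pairing, horth _ hv _ hai]
          simpa using hv
        · exact Or.inr (S'.sub_mem hv (S'.smul_mem _ hai))
  obtain ⟨i, hi⟩ := hs
  obtain ⟨j, hj⟩ := hs'
  obtain ⟨α, hα, β, hβ, hne⟩ := h.irreducible (F ∩ S) (F ∩ S')
    ⟨a i, b.mem i, Submodule.subset_span ⟨i, hi, rfl⟩⟩
    ⟨a j, b.mem j, Submodule.subset_span ⟨j, hj, rfl⟩⟩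
    (by
      ext α
      constructor
      · rintro (hα | hα) <;> exact hα.1
      · intro hα
        exact (hcover α hα).imp (fun h => ⟨hα, h⟩) (fun h => ⟨hα, h⟩))
  exact hne (horth _ hα.2 _ hβ.2)

/-- A non-empty set of roots that is stable under the simple reflections contains a dominant root,
and all coefficients of that root are positive. -/
theorem exists_dominant (b : IsBase B F a) (h : IsFinRootSystem B F) {D : Set V} (hDF : D ⊆ F)
    (hD : D.Nonempty) (hstab : ∀ i, ∀ α ∈ D, refl B (a i) α ∈ D) :
    ∃ θ ∈ D, (∀ i, 0 ≤ B θ (a i)) ∧ ∃ c : ι → ℕ, (∀ i, 0 < c i) ∧ θ = ∑ i, (c i : ℝ) • a i := by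
  have hli : LinearIndepOn ℝ a Set.univ :=
    linearIndepOn_univ_iff.2 (LinearIndependent.of_comp (radical B).mkQ b.indep)
  -- `f` is the height. An element of `D` of maximal height is dominant, since reflecting in a
  -- simple root of negative pairing would raise its height.
  obtain ⟨f, hf⟩ := Module.exists_dual_forall_apply_eq_one hli
  obtain ⟨θ, hθ, hmax⟩ := (h.finite.subset hDF).exists_maximalFor f D hD
  have hdom : ∀ i, 0 ≤ B θ (a i) := by
    intro i
    by_contra! hcon
    have hp : pairing B θ (a i) < 0 := by
      rw [pairing]
      exact div_neg_of_neg_of_pos (by linarith) (h.pos (b.mem i))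
    have hfeq : f (refl B (a i) θ) = f θ - pairing B θ (a i) := by
      rw [refl, map_sub, map_smul, hf i (Set.mem_univ i), smul_eq_mul, mul_one]
    have := hmax (hstab i θ hθ) (by linarith)
    linarith
  refine ⟨θ, hθ, hdom, ?_⟩
  rcases b.exists_coeff (hDF hθ) with ⟨c, hc⟩ | ⟨c, hc⟩
  · refine ⟨c, ?_, hc⟩
    by_contra! hcon
    obtain ⟨j₀, hj₀⟩ := hcon
    have hne : {i | 0 < c i}.Nonempty := by
      by_contra hemp
      rw [Set.not_nonempty_iff_eq_empty, Set.eq_empty_iff_forall_notMem] at hemp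
      have hc0 : ∀ i, c i = 0 := fun i => Nat.eq_zero_of_not_pos (hemp i)
      refine h.notMem_radical θ (hDF hθ) ?_
      rw [hc]
      simp [hc0]
    -- If the support were proper, some `a j` outside it would be non-orthogonal to an `a i` inside.
    -- All terms of `(θ, a j)` are then `≤ 0`, and dominance forces each to vanish, including the
    -- one at `i`.
    obtain ⟨i, hi, j, hj, hij⟩ := b.exists_apply_ne_zero h hne
      ⟨j₀, by simpa using Nat.le_zero.1 hj₀⟩
    have hj' : c j = 0 := Nat.eq_zero_of_not_pos hj
    have hterm : ∀ k, (c k : ℝ) * B (a k) (a j) ≤ 0 := by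
      intro k
      rcases eq_or_ne k j with rfl | hkj
      · simp [hj']
      · exact mul_nonpos_of_nonneg_of_nonpos (Nat.cast_nonneg _) (b.nonpos _ _ hkj)
    have hsum : B θ (a j) = ∑ k, (c k : ℝ) * B (a k) (a j) := by
      rw [hc]
      simp only [map_sum, LinearMap.sum_apply, map_smul, LinearMap.smul_apply, smul_eq_mul]
    have h0 : ∑ k, (c k : ℝ) * B (a k) (a j) = 0 :=
      le_antisymm (Finset.sum_nonpos fun k _ => hterm k) (hsum ▸ hdom j)
    rw [Finset.sum_eq_zero_iff_of_nonpos fun k _ => hterm k] at h0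
    rcases mul_eq_zero.1 (h0 i (Finset.mem_univ i)) with h' | h'
    · have hi' : 0 < c i := hi
      exact hi'.ne' (by exact_mod_cast h')
    · exact hij h'
  · exfalso
    have h1 : B θ θ = -∑ i, (c i : ℝ) * B θ (a i) := by
      have : B θ θ = B θ (-∑ i, (c i : ℝ) • a i) := congrArg (B θ) hc
      simpa only [map_neg, map_sum, map_smul, smul_eq_mul] using this
    have h2 := h.pos (hDF hθ)
    have h3 : 0 ≤ ∑ i, (c i : ℝ) * B θ (a i) :=
      Finset.sum_nonneg fun i _ => mul_nonneg (Nat.cast_nonneg _) (hdom i)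
    linarith

/-- No root is orthogonal to a whole Weyl group orbit of roots. -/
theorem exists_conj_apply_ne_zero (b : IsBase B F a) (h : IsFinRootSystem B F) {α θ : V}
    (hα : α ∈ F) (hθ : θ ∈ F) : ∃ w ∈ weylGroup B a, B α (w θ) ≠ 0 := by
  by_contra! hcon
  obtain ⟨β, ⟨hβ, w, hw, hne⟩, γ, ⟨hγ, hγ0⟩, hβγ⟩ := h.irreducible
    {β | β ∈ F ∧ ∃ w ∈ weylGroup B a, B β (w θ) ≠ 0}
    {β | β ∈ F ∧ ∀ w ∈ weylGroup B a, B β (w θ) = 0}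
    ⟨θ, hθ, 1, one_mem _, h.norm_ne hθ⟩ ⟨α, hα, hcon⟩
    (by
      ext x
      constructor
      · rintro (hx | hx) <;> exact hx.1
      · intro hx
        by_cases hx' : ∃ w ∈ weylGroup B a, B x (w θ) ≠ 0
        · exact Or.inl ⟨hx, hx'⟩
        · push Not at hx'
          exact Or.inr ⟨hx, hx'⟩)
  obtain ⟨g, hg, hgβ⟩ :=
    h.psd.exists_weylGroup_eq_refl (b.norm_ne h) (b.subset_simpleOrbit h hβ)
  -- `γ` is orthogonal to both `wθ` and its reflection in `β`. These differ by a non-zero multiple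
  -- of `β`, so `γ` is orthogonal to `β`.
  have h1 := hγ0 (g * w) (mul_mem hg hw)
  rw [LinearEquiv.mul_apply, hgβ, refl, map_sub, hγ0 w hw, map_smul, zero_sub, neg_eq_zero,
    smul_eq_mul] at h1
  rcases mul_eq_zero.1 h1 with h2 | h2
  · rw [pairing, div_eq_zero_iff] at h2
    rcases h2 with h2 | h2
    · exact hne (by rw [h.psd.symm]; linarith)
    · exact h.norm_ne hβ h2
  · exact hβγ (by rw [h.psd.symm]; exact h2)

end IsBase

end Bases

/-! ### Level functions and admissible translates -/

section Affinization

variable {V : Type*} [AddCommGroup V] [Module ℝ V] {B : LinearMap.BilinForm ℝ V} {F : Set V}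
  {m : V → ℕ}

/-- A function on a finite root system that is admissible as the function describing the isotropic
translates of the roots: the translates of `α` are the `α + k • l` with `m α ∣ k`. -/
structure IsLevel (B : LinearMap.BilinForm ℝ V) (F : Set V) (m : V → ℕ) : Prop where
  pos : ∀ α ∈ F, 0 < m α
  refl : ∀ α ∈ F, ∀ β ∈ F, m (refl B α β) = m β
  dvd : ∀ α ∈ F, ∀ β ∈ F, ∀ n : ℤ, pairing B α β = n → (m α : ℤ) ∣ n * m β

/-- The set of all `α + k • l` with `m α ∣ k`. -/
def levelTranslates (F : Set V) (m : V → ℕ) (l : V) : Set V :=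
  {x | ∃ α ∈ F, ∃ k : ℤ, (m α : ℤ) ∣ k ∧ x = α + k • l}

theorem weylGroup_mem_and_eq {n : ℕ} {a : Fin n → V} (h : IsFinRootSystem B F)
    (b : IsBase B F a) (hm : IsLevel B F m) {w : V ≃ₗ[ℝ] V} (hw : w ∈ weylGroup B a) {θ : V}
    (hθ : θ ∈ F) : w θ ∈ F ∧ m (w θ) = m θ :=
  weylGroup_induction (p := fun v => v ∈ F ∧ m v = m θ) (b.norm_ne h)
    (fun i v hv => ⟨h.refl_mem _ (b.mem i) _ hv.1, by rw [hm.refl _ (b.mem i) _ hv.1, hv.2]⟩) hw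
    ⟨hθ, rfl⟩

/-- Relation of the level of a root to that of the longest roots of minimal level. -/
theorem exists_conj_dvd_level {n : ℕ} {a : Fin n → V} (h : IsFinRootSystem B F)
    (b : IsBase B F a) (hm : IsLevel B F m) {θ : V} (hθ : θ ∈ F) (hmin : ∀ α ∈ F, m θ ≤ m α)
    (hmax : ∀ α ∈ F, m α = m θ → B α α ≤ B θ θ) {α : V} (hα : α ∈ F) :
    (∃ w ∈ weylGroup B a, α = w θ) ∨ ∃ w ∈ weylGroup B a, ∃ k : ℤ, pairing B α (w θ) = k ∧
      (k * m θ) ∣ (m α : ℤ) := by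
  obtain ⟨w, hw, hne⟩ := b.exists_conj_apply_ne_zero h hα hθ
  obtain ⟨hwF, hwm⟩ := weylGroup_mem_and_eq h b hm hw hθ
  have hwB : B (w θ) (w θ) = B θ θ := h.psd.weylGroup_isometry (b.norm_ne h) hw θ θ
  by_cases h1 : α = w θ
  · exact Or.inl ⟨w, hw, h1⟩
  by_cases h2 : α = -w θ
  · left
    obtain ⟨g, hg, hgθ⟩ :=
      h.psd.exists_weylGroup_eq_refl (b.norm_ne h) (b.subset_simpleOrbit h hwF)
    exact ⟨g * w, mul_mem hg hw, by
      rw [LinearEquiv.mul_apply, hgθ, refl_self (h.norm_ne hwF), h2]⟩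
  right
  obtain ⟨k, k', hk, hk', hpos, hlt⟩ := h.exists_pairing hα hwF h1 h2 hne
  refine ⟨w, hw, k, hk, ?_⟩
  have d1 : (m α : ℤ) ∣ k * m θ := hwm ▸ hm.dvd _ hα _ hwF k hk
  have d2 : (m θ : ℤ) ∣ k' * m α := hwm ▸ hm.dvd _ hwF _ hα k' hk'
  have hθpos := hm.pos θ hθ
  have habs : k.natAbs * k'.natAbs < 4 := by
    rw [← Int.natAbs_mul]; omega
  have hk0 : k.natAbs ≠ 0 := by
    rw [Ne, Int.natAbs_eq_zero]; rintro rfl; simp at hpos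
  have hk'0 : k'.natAbs ≠ 0 := by
    rw [Ne, Int.natAbs_eq_zero]; rintro rfl; simp at hpos
  -- From here only absolute values matter: `|k||k'| ≤ 3`, so one of the two is `1`.
  rw [← Int.natAbs_dvd_natAbs, Int.natAbs_mul, Int.natAbs_natCast, Int.natAbs_natCast] at d1 d2 ⊢
  by_cases hk'1 : k'.natAbs = 1
  · rw [hk'1, one_mul] at d2
    obtain ⟨e, he⟩ := d2
    rw [he, mul_comm (m θ) e] at d1
    have d3 : e ∣ k.natAbs := Nat.dvd_of_mul_dvd_mul_right hθpos d1
    rw [hk'1, mul_one] at habs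
    -- With `|k'| = 1`, `m α = m θ * e` where `e` divides `|k|`, which is `1`, `2` or `3`. Either `e
    -- = |k|`, which is the claim, or `e = 1`; then `α` also has minimal level, and `(α, α) ≤ (θ,
    -- θ)` forces `|k| = 1`.
    have he0 : e = 1 ∨ e = k.natAbs := by
      have : k.natAbs = 1 ∨ k.natAbs.Prime := by
        rcases (by omega : k.natAbs = 1 ∨ k.natAbs = 2 ∨ k.natAbs = 3) with h' | h' | h'
        · exact Or.inl h'
        · right; rw [h']; exact Nat.prime_two
        · right; rw [h']; exact Nat.prime_three
      rcases this with h' | h'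
      · rw [h'] at d3
        exact Or.inl (Nat.dvd_one.1 d3)
      · exact (Nat.dvd_prime h').1 d3
    rcases he0 with rfl | rfl
    · rw [mul_one] at he
      have hle := hmax α hα he
      have hBα := h.pos hα
      have hBθ := h.pos hθ
      have hrel : (k : ℝ) * B θ θ = k' * B α α := by
        rw [← hk, ← hk', pairing, pairing, hwB, h.psd.symm (w θ) α]
        field_simp
      have hrel' : |(k : ℝ)| * B θ θ = |(k' : ℝ)| * B α α := by
        have := congrArg abs hrel
        rwa [abs_mul, abs_mul, abs_of_pos hBα, abs_of_pos hBθ] at this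
      have hk'abs : |(k' : ℝ)| = 1 := by
        rw [← Int.cast_abs, Int.abs_eq_natAbs, hk'1]; simp
      have hkabs : |(k : ℝ)| ≤ 1 := by
        rw [hk'abs, one_mul] at hrel'
        by_contra! hcon
        nlinarith
      have : k.natAbs ≤ 1 := by
        rw [← Int.cast_abs, Int.abs_eq_natAbs] at hkabs
        exact_mod_cast hkabs
      rw [show k.natAbs = 1 by omega, one_mul, he]
    · rw [he, mul_comm]
  -- Now `|k| = 1`, so `m α` divides `m θ`, and minimality gives equality.
  · have hk1 : k.natAbs = 1 := by
      by_contra hcon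
      have h1 : 2 ≤ k.natAbs := by omega
      have h2 : 2 ≤ k'.natAbs := by omega
      nlinarith
    rw [hk1, one_mul] at d1 ⊢
    rw [le_antisymm (hmin α hα) (Nat.le_of_dvd hθpos d1)]

theorem minimal_level_dvd {n : ℕ} {a : Fin n → V} (h : IsFinRootSystem B F)
    (b : IsBase B F a) (hm : IsLevel B F m) {θ : V} (hθ : θ ∈ F) (hmin : ∀ α ∈ F, m θ ≤ m α)
    (hmax : ∀ α ∈ F, m α = m θ → B α α ≤ B θ θ) {α : V} (hα : α ∈ F) : (m θ : ℤ) ∣ m α := by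
  rcases exists_conj_dvd_level h b hm hθ hmin hmax hα with ⟨w, hw, rfl⟩ | ⟨w, -, k, -, hk⟩
  · rw [(weylGroup_mem_and_eq h b hm hw hθ).2]
  · exact (Dvd.intro_left k rfl).trans hk

/-- A longest root of minimal level can be chosen dominant. -/
theorem exists_dominant_minimal_level {n : ℕ} {a : Fin n → V} (h : IsFinRootSystem B F)
    (b : IsBase B F a) (hm : IsLevel B F m) : ∃ θ ∈ F, (∀ i, 0 ≤ B θ (a i)) ∧
      (∃ c : Fin n → ℕ, (∀ i, 0 < c i) ∧ θ = ∑ i, (c i : ℝ) • a i) ∧ (∀ α ∈ F, m θ ≤ m α) ∧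
      ∀ α ∈ F, m α = m θ → B α α ≤ B θ θ := by
  obtain ⟨α₀, hα₀, hmin⟩ := h.finite.exists_minimalFor m F h.nonempty
  obtain ⟨β₀, ⟨hβ₀, hβm⟩, hmax⟩ := (h.finite.subset
    (fun x hx => hx.1 : {α | α ∈ F ∧ m α = m α₀} ⊆ F)).exists_maximalFor (fun α => B α α) _
    ⟨α₀, hα₀, rfl⟩
  -- Level and length are both Weyl invariant, so the roots sharing those of `β₀` form a stable set,
  -- which has a dominant member.
  obtain ⟨θ, ⟨hθ, hθm, hθB⟩, hdom, hc⟩ := b.exists_dominant h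
    (D := {α | α ∈ F ∧ m α = m α₀ ∧ B α α = B β₀ β₀}) (fun x hx => hx.1) ⟨β₀, hβ₀, hβm, rfl⟩
    (fun i α hα => ⟨h.refl_mem _ (b.mem i) _ hα.1, by rw [hm.refl _ (b.mem i) _ hα.1, hα.2.1],
      by rw [h.psd.refl_isometry (b.norm_ne h i), hα.2.2]⟩)
  refine ⟨θ, hθ, hdom, hc, fun α hα => ?_, fun α hα hαm => ?_⟩
  · rw [hθm]
    exact (le_total _ _).elim id fun h' => hmin hα h'
  · rw [hθB]
    exact (le_total _ _).elim id fun h' => hmax ⟨hα, hαm.trans hθm⟩ h'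

/-! ### The extended base, its translations and its orbit -/

section Extended

variable {n : ℕ} {a : Fin n → V} {θ δ : V}

theorem norm_sub (h : IsFinRootSystem B F) (hδ : δ ∈ radical B) (θ : V) :
    B (δ - θ) (δ - θ) = B θ θ := by
  simp [apply_of_mem_radical hδ, h.psd.apply_right_of_mem_radical hδ]

theorem norm_extended_ne (h : IsFinRootSystem B F) (b : IsBase B F a) (hθ : θ ∈ F)
    (hδ : δ ∈ radical B) (i : Fin (n + 1)) :
    B ((Fin.cons (δ - θ) a : Fin (n + 1) → V) i) ((Fin.cons (δ - θ) a : Fin (n + 1) → V) i) ≠ 0 := by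
  refine Fin.cases ?_ (fun i => ?_) i
  · simp only [Fin.cons_zero, norm_sub h hδ]
    exact h.norm_ne hθ
  · simpa only [Fin.cons_succ] using b.norm_ne h i

theorem weylGroup_le_extended : weylGroup B a ≤
    weylGroup B (Fin.cons (δ - θ) a : Fin (n + 1) → V) := by
  refine Subgroup.closure_mono ?_
  rintro g ⟨i, hi⟩
  exact ⟨i.succ, by simpa only [Fin.cons_succ] using hi⟩

theorem pairing_extended (h : IsFinRootSystem B F) (hδ : δ ∈ radical B) (v : V) :
    pairing B v (δ - θ) = -pairing B v θ := by
  rw [sub_eq_neg_add, h.psd.pairing_add_radical_right hδ, pairing_neg_right]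

/-- The affine Weyl group contains the translations in the directions conjugate to `θ`. -/
theorem exists_translation (h : IsFinRootSystem B F) (b : IsBase B F a) (hθ : θ ∈ F)
    (hδ : δ ∈ radical B) {w : V ≃ₗ[ℝ] V} (hw : w ∈ weylGroup B a) :
    ∃ g ∈ weylGroup B (Fin.cons (δ - θ) a : Fin (n + 1) → V),
      ∀ v, g v = v - pairing B v (w θ) • δ := by
  have hW := weylGroup_le_extended (B := B) (a := a) (δ := δ) (θ := θ)
  obtain ⟨g, hg, hgθ⟩ := h.psd.exists_weylGroup_eq_refl (b.norm_ne h) (b.subset_simpleOrbit h hθ)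
  have h0 := reflEquiv_mem_weylGroup (B := B) (a := (Fin.cons (δ - θ) a : Fin (n + 1) → V)) 0
    (norm_extended_ne h b hθ hδ 0)
  -- The reflections in `θ` and `δ - θ` are parallel modulo the radical, so their product is a
  -- translation; conjugating by `w` replaces `θ` by `w θ`.
  refine ⟨w * (reflEquiv B _ (norm_extended_ne h b hθ hδ 0) * g) * w⁻¹,
    mul_mem (mul_mem (hW hw) (mul_mem h0 (hW hg))) (inv_mem (hW hw)), fun v => ?_⟩
  have hwv : w (w⁻¹ v) = v := by simp
  have hp : pairing B (w⁻¹ v) θ = pairing B v (w θ) := by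
    conv_rhs => rw [← hwv]
    simp only [pairing, h.psd.weylGroup_isometry (b.norm_ne h) hw]
  have ht : ∀ x, refl B (δ - θ) (refl B θ x) = x - pairing B x θ • δ := by
    intro x
    have h1 : pairing B (refl B θ x) θ = -pairing B x θ := by
      rw [refl, sub_eq_add_neg, pairing_add_left, pairing_neg_left, pairing_smul_left,
        pairing_self (h.norm_ne hθ)]
      ring
    rw [refl.eq_def B (δ - θ), pairing_extended h hδ, h1, refl]
    module
  simp only [LinearEquiv.mul_apply, reflEquiv_apply, hgθ, Fin.cons_zero]
  rw [ht, map_sub, map_smul, hwv, hp, weylGroup_apply_of_mem_radical (b.norm_ne h) hw hδ]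

/-- The orbits of the affine Weyl group are stable under the translations conjugate to `θ`. -/
theorem add_mem_simpleOrbit_extended (h : IsFinRootSystem B F) (b : IsBase B F a) (hθ : θ ∈ F)
    (hδ : δ ∈ radical B) {w : V ≃ₗ[ℝ] V} (hw : w ∈ weylGroup B a) {v : V} {k : ℤ}
    (hk : pairing B v (w θ) = k)
    (hv : v ∈ simpleOrbit B (Fin.cons (δ - θ) a : Fin (n + 1) → V)) (j : ℤ) :
    v + (j * k) • δ ∈ simpleOrbit B (Fin.cons (δ - θ) a : Fin (n + 1) → V) := by
  obtain ⟨g, hg, hgv⟩ := exists_translation h b hθ hδ hw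
  have hstep : ∀ i : ℤ, g (v + i • δ) = v + (i - k) • δ := by
    intro i
    rw [hgv, pairing_add_radical_left ((radical B).smul_of_tower_mem i hδ), hk,
      Int.cast_smul_eq_zsmul]
    module
  have hinv : ∀ i : ℤ, g⁻¹ (v + i • δ) = v + (i + k) • δ := by
    intro i
    have := hstep (i + k)
    rw [add_sub_cancel_right] at this
    rw [← this]
    simp
  induction j using Int.induction_on with
  | zero => simpa using hv
  | succ j ih =>
    have := apply_mem_simpleOrbit (inv_mem hg) ih
    rw [hinv] at this
    convert this using 3
    ring
  | pred j ih =>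
    have := apply_mem_simpleOrbit hg ih
    rw [hstep] at this
    convert this using 3
    ring

/-- The real roots: the orbit of the extended base consists of the admissible translates. -/
theorem simpleOrbit_extended_eq (h : IsFinRootSystem B F) (b : IsBase B F a) (hm : IsLevel B F m)
    (hθ : θ ∈ F) (hmin : ∀ α ∈ F, m θ ≤ m α) (hmax : ∀ α ∈ F, m α = m θ → B α α ≤ B θ θ)
    {l : V} (hl : l ∈ radical B) :
    simpleOrbit B (Fin.cons ((m θ : ℤ) • l - θ) a : Fin (n + 1) → V) = levelTranslates F m l := by
  have hδ : (m θ : ℤ) • l ∈ radical B := (radical B).smul_of_tower_mem _ hl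
  have hnorm := norm_extended_ne h b hθ hδ
  have hW := weylGroup_le_extended (B := B) (a := a) (δ := (m θ : ℤ) • l) (θ := θ)
  have hmneg : m (-θ) = m θ := by
    have := hm.refl θ hθ θ hθ
    rwa [refl_self (h.norm_ne hθ)] at this
  apply Set.Subset.antisymm
  · intro x hx
    refine simpleOrbit_induction (p := fun v => v ∈ levelTranslates F m l) hnorm ?_ ?_ hx
    · refine Fin.cases ?_ fun i => ?_
      · exact ⟨-θ, h.neg_mem hθ, m θ, by rw [hmneg], by rw [Fin.cons_zero]; abel⟩
      · exact ⟨a i, b.mem i, 0, dvd_zero _, by rw [Fin.cons_succ, zero_smul, add_zero]⟩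
    · rintro i v ⟨α, hα, k, hk, rfl⟩
      have hkl : k • l ∈ radical B := (radical B).smul_of_tower_mem _ hl
      refine Fin.cases ?_ (fun i => ?_) i
      · rw [Fin.cons_zero]
        obtain ⟨p, hp⟩ := h.integral θ hθ α hα
        -- Reflecting in `δ - θ` acts as the reflection in `θ` on the finite part and adds `p δ`,
        -- where `p = (α, θ^∨)`; the axiom `IsLevel.dvd` keeps the shift admissible.
        refine ⟨refl B θ α, h.refl_mem θ hθ α hα, k + p * m θ, ?_, ?_⟩
        · rw [hm.refl θ hθ α hα]
          exact dvd_add hk (hm.dvd α hα θ hθ p hp)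
        · rw [refl, pairing_add_radical_left hkl, pairing_extended h hδ, refl, hp, neg_smul,
            Int.cast_smul_eq_zsmul, Int.cast_smul_eq_zsmul]
          module
      · rw [Fin.cons_succ, refl_add, refl_of_mem_radical hkl]
        exact ⟨refl B (a i) α, h.refl_mem _ (b.mem i) α hα, k, by rwa [hm.refl _ (b.mem i) α hα],
          rfl⟩
  · rintro x ⟨α, hα, k, hk, rfl⟩
    have hsub : ∀ β ∈ F, β ∈ simpleOrbit B (Fin.cons ((m θ : ℤ) • l - θ) a : Fin (n + 1) → V) := by
      intro β hβ
      obtain ⟨w, hw, i, rfl⟩ := b.subset_simpleOrbit h hβ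
      exact ⟨w, hW hw, i.succ, by rw [Fin.cons_succ]⟩
    rcases exists_conj_dvd_level h b hm hθ hmin hmax hα with ⟨w, hw, rfl⟩ | ⟨w, hw, p, hp, hpd⟩
    · obtain ⟨hwF, hwm⟩ := weylGroup_mem_and_eq h b hm hw hθ
      rw [hwm] at hk
      obtain ⟨j, rfl⟩ := hk
      have h2 : ∀ s ∈ radical B, pairing B (w θ + s) (w θ) = ((2 : ℤ) : ℝ) := by
        intro s hs
        rw [pairing_add_radical_left hs, pairing_self (h.norm_ne hwF)]
        norm_num
      -- Since `(wθ, (wθ)^∨) = 2`, translations reach only shifts by even multiples of `δ`. Odd ones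
      -- start from `wθ + δ`, the image of `δ - θ` under the reflection in `wθ` composed with `w`.
      rcases Int.even_or_odd' j with ⟨i, rfl | rfl⟩
      · have := add_mem_simpleOrbit_extended h b hθ hδ hw (k := 2)
          (by have := h2 0 (Submodule.zero_mem _); rwa [add_zero] at this) (hsub _ hwF) i
        convert this using 2
        rw [smul_smul]
        congr 1
        ring
      · obtain ⟨g, hg, hgθ⟩ :=
          h.psd.exists_weylGroup_eq_refl (b.norm_ne h) (b.subset_simpleOrbit h hwF)
        have hmem : w θ + (m θ : ℤ) • l ∈
            simpleOrbit B (Fin.cons ((m θ : ℤ) • l - θ) a : Fin (n + 1) → V) := by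
          refine ⟨g * w, hW (mul_mem hg hw), 0, ?_⟩
          rw [Fin.cons_zero, map_sub, weylGroup_apply_of_mem_radical (b.norm_ne h)
            (mul_mem hg hw) hδ, LinearEquiv.mul_apply, hgθ, refl_self (h.norm_ne hwF)]
          abel
        have := add_mem_simpleOrbit_extended h b hθ hδ hw (h2 _ hδ) hmem i
        convert this using 1
        module
    · obtain ⟨j, rfl⟩ := hpd.trans hk
      have := add_mem_simpleOrbit_extended h b hθ hδ hw hp (hsub _ hα) j
      convert this using 2
      rw [smul_smul]
      congr 1
      ring

end Extended

end Affinization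

/-! ### Isotropic strings through a root -/

section Strings

/-- A set of integers closed under point reflections, containing `0` and a non-zero element, is a
subgroup. -/
theorem exists_dvd_of_reflection_closed {S : Set ℤ} (h0 : 0 ∈ S)
    (hS : ∀ s ∈ S, ∀ t ∈ S, 2 * s - t ∈ S) {k : ℤ} (hk : k ∈ S) (hk0 : k ≠ 0) :
    ∃ m : ℕ, 0 < m ∧ ∀ j : ℤ, j ∈ S ↔ (m : ℤ) ∣ j := by
  classical
  have hneg : ∀ s ∈ S, -s ∈ S := fun s hs => by simpa using hS 0 h0 s hs
  have habs : ∀ s ∈ S, (s.natAbs : ℤ) ∈ S := by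
    intro s hs
    rcases Int.natAbs_eq s with h | h
    · rwa [← h]
    · have := hneg s hs
      rw [h] at this
      simpa using this
  have hex : ∃ m : ℕ, 0 < m ∧ (m : ℤ) ∈ S :=
    ⟨k.natAbs, Int.natAbs_pos.2 hk0, habs k hk⟩
  obtain ⟨m, ⟨hm0, hmS⟩, hmin⟩ : ∃ m : ℕ, (0 < m ∧ (m : ℤ) ∈ S) ∧
      ∀ j : ℕ, 0 < j → (j : ℤ) ∈ S → m ≤ j :=
    ⟨Nat.find hex, Nat.find_spec hex, fun j hj hjS => Nat.find_min' hex ⟨hj, hjS⟩⟩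
  -- Reflecting at `0` and then at the least positive element `m` is the shift by `2m`. A residue
  -- `r` modulo `2m` in `S` is `0`, or else both `r` and `2m - r` are at least `m`, so `r = m`.
  have hadd : ∀ s ∈ S, s + 2 * m ∈ S := by
    intro s hs
    have := hS m hmS _ (hneg s hs)
    rwa [sub_neg_eq_add, add_comm] at this
  have hsub : ∀ s ∈ S, s - 2 * m ∈ S := by
    intro s hs
    have := hneg _ (hadd _ (hneg s hs))
    rwa [neg_add, neg_neg, ← sub_eq_add_neg] at this
  have hshift : ∀ s ∈ S, ∀ i : ℤ, s + i * (2 * m) ∈ S := by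
    intro s hs i
    induction i using Int.induction_on with
    | zero => simpa using hs
    | succ i ih => convert hadd _ ih using 1; ring
    | pred i ih => convert hsub _ ih using 1; ring
  refine ⟨m, hm0, fun j => ⟨fun hj => ?_, ?_⟩⟩
  · have hr := hshift j hj (-(j / (2 * m)))
    have hr' : j + -(j / (2 * m)) * (2 * m) = j % (2 * m) := by
      rw [Int.emod_def]; ring
    rw [hr'] at hr
    have hr0 : 0 ≤ j % (2 * m) := Int.emod_nonneg _ (by omega)
    have hr1 : j % (2 * m) < 2 * m := Int.emod_lt_of_pos _ (by omega)
    have hdj : (m : ℤ) ∣ j ↔ (m : ℤ) ∣ j % (2 * m) := by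
      rw [Int.emod_def]
      exact (dvd_sub_left (Dvd.dvd.mul_right (Dvd.intro_left 2 rfl) _)).symm
    rw [hdj]
    rcases hr0.eq_or_lt with h' | h'
    · rw [← h']; exact dvd_zero _
    · have h1 : (m : ℤ) ≤ j % (2 * m) := by
        have := hmin (j % (2 * m)).toNat (by omega) (by rwa [Int.toNat_of_nonneg hr0])
        omega
      have h2 : (m : ℤ) ≤ 2 * m - j % (2 * m) := by
        have := hmin (2 * m - j % (2 * m)).toNat (by omega) (by
          rw [Int.toNat_of_nonneg (by omega)]
          have := hneg _ (hsub _ hr)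
          rwa [neg_sub] at this)
        omega
      rw [show j % (2 * m) = m by omega]
  · rintro ⟨c, rfl⟩
    rcases Int.even_or_odd' c with ⟨i, rfl | rfl⟩
    · convert hshift 0 h0 i using 1; ring
    · convert hshift m hmS i using 1; ring

variable {V : Type*} [AddCommGroup V] [Module ℝ V] {B : LinearMap.BilinForm ℝ V} {R : Set V}

theorem add_radical_notMem {α s : V} (hα : α ∉ radical B) (hs : s ∈ radical B) :
    α + s ∉ radical B := fun h => hα (by
  have := (radical B).sub_mem h hs
  rwa [add_sub_cancel_right] at this)

theorem neg_mem_of_refl_mem (hB : IsSymmPSD B) (hR : ∀ α ∈ nonIso B R, ∀ β ∈ R, refl B α β ∈ R)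
    {α : V} (hα : α ∈ nonIso B R) : -α ∈ nonIso B R := by
  have h := mem_nonIso.1 hα
  refine mem_nonIso.2 ⟨?_, fun h' => h.2 (by simpa using (radical B).neg_mem h')⟩
  rw [← refl_self (hB.pos_of_notMem h.2).ne']
  exact hR α hα α h.1

/-- Isotropic translates of a root are closed under point reflections. -/
theorem add_two_smul_sub_mem (hB : IsSymmPSD B)
    (hR : ∀ α ∈ nonIso B R, ∀ β ∈ R, refl B α β ∈ R) {α s t : V} (hα : α ∉ radical B)
    (hs : s ∈ radical B) (ht : t ∈ radical B) (hαs : α + s ∈ R) (hαt : α + t ∈ R) :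
    α + ((2 : ℤ) • s - t) ∈ R := by
  have h1 := hR _ (mem_nonIso.2 ⟨hαs, add_radical_notMem hα hs⟩) _ hαt
  -- Reflecting `α + t` in `α + s` is the point reflection of `t` at `s`, up to an overall sign
  -- removed afterwards.
  have h2 : refl B (α + s) (α + t) = -(α + ((2 : ℤ) • s - t)) := by
    rw [refl, pairing_add_radical_left ht, hB.pairing_add_radical_right hs,
      pairing_self (hB.pos_of_notMem hα).ne']
    module
  rw [h2] at h1
  have h3 : -(α + ((2 : ℤ) • s - t)) ∉ radical B := fun h => by
    refine add_radical_notMem hα ((radical B).sub_mem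
      ((radical B).smul_of_tower_mem (2 : ℤ) hs) ht) ?_
    simpa using (radical B).neg_mem h
  have h4 := (mem_nonIso.1 (neg_mem_of_refl_mem hB hR (mem_nonIso.2 ⟨h1, h3⟩))).1
  rwa [neg_neg] at h4

/-- The isotropic translates `α + k • s` of a root that are roots form a full arithmetic
progression as soon as there is more than one of them. -/
theorem exists_level (hB : IsSymmPSD B) (hR : ∀ α ∈ nonIso B R, ∀ β ∈ R, refl B α β ∈ R)
    {α s : V} (hα : α ∈ nonIso B R) (hs : s ∈ radical B) {k : ℤ} (hk : k ≠ 0)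
    (hαk : α + k • s ∈ R) : ∃ m : ℕ, 0 < m ∧ ∀ j : ℤ, α + j • s ∈ R ↔ (m : ℤ) ∣ j := by
  obtain ⟨h1, h2⟩ := mem_nonIso.1 hα
  refine exists_dvd_of_reflection_closed (S := {j : ℤ | α + j • s ∈ R}) (by simpa using h1) ?_
    hαk hk
  intro i hi j hj
  have := add_two_smul_sub_mem hB hR h2 ((radical B).smul_of_tower_mem i hs)
    ((radical B).smul_of_tower_mem j hs) hi hj
  rw [smul_smul, ← sub_smul] at this
  exact this

/-- Isotropic translations of a root act on all other roots. -/
theorem add_pairing_smul_mem (hB : IsSymmPSD B)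
    (hR : ∀ α ∈ nonIso B R, ∀ β ∈ R, refl B α β ∈ R) {α β s : V} (hα : α ∈ R)
    (hβ : β ∈ nonIso B R) (hs : s ∈ radical B) (hβs : β + s ∈ R) {n : ℤ}
    (hn : pairing B α β = n) : α + n • s ∈ R := by
  have hβ' := (mem_nonIso.1 hβ).2
  have h1 := hR _ (mem_nonIso.2 ⟨hβs, add_radical_notMem hβ' hs⟩) _ (hR β hβ α hα)
  have h2 : pairing B (refl B β α) β = -pairing B α β := by
    rw [refl, sub_eq_add_neg, pairing_add_left, pairing_neg_left, pairing_smul_left,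
      pairing_self (hB.pos_of_notMem hβ').ne']
    ring
  have h3 : refl B (β + s) (refl B β α) = α + n • s := by
    rw [refl.eq_def B (β + s), hB.pairing_add_radical_right hs, h2, refl, hn, neg_smul,
      Int.cast_smul_eq_zsmul, Int.cast_smul_eq_zsmul]
    module
  rwa [h3] at h1

end Strings

/-! ### Non-trivial translates in every direction of the isotropic lattice -/

section EARS

variable {V : Type*} [AddCommGroup V] [Module ℝ V] {B : LinearMap.BilinForm ℝ V} {R : Set V}

theorem IsEARS.psd (hR : IsEARS B R) : IsSymmPSD B := ⟨hR.symm, hR.posSemidef⟩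

/-- In an irreducible system, every root has a non-trivial translate in each direction of `R⁰`. -/
theorem IsEARS.exists_smul_iso (hR : IsEARS B R) (hirr : IsIrreducible B R) {s : V}
    (hs : s ∈ iso B R) : ∀ α ∈ nonIso B R, ∃ k : ℤ, k ≠ 0 ∧ α + k • s ∈ R := by
  by_contra! hcon
  obtain ⟨γ, hγ, hγs⟩ := hcon
  have hsr : s ∈ radical B := hs.2
  apply hirr
  refine ⟨{α | α ∈ nonIso B R ∧ ∃ k : ℤ, k ≠ 0 ∧ α + k • s ∈ R},
    {α | α ∈ nonIso B R ∧ ∀ k : ℤ, k ≠ 0 → α + k • s ∉ R}, ?_, ⟨γ, hγ, hγs⟩, ?_, ?_⟩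
  · rw [hR.iso_eq] at hs
    obtain ⟨-, α, hα, β, hβ, rfl⟩ := hs
    -- An isotropic root is a difference `s = α - β`, so `β + s = α` is the initial non-trivial
    -- translate.
    exact ⟨β, hβ, 1, one_ne_zero, by simpa using (mem_nonIso.1 hα).1⟩
  · ext x
    constructor
    · rintro (hx | hx) <;> exact hx.1
    · intro hx
      by_cases hx' : ∃ k : ℤ, k ≠ 0 ∧ x + k • s ∈ R
      · exact Or.inl ⟨hx, hx'⟩
      · push Not at hx'
        exact Or.inr ⟨hx, hx'⟩
  · rintro α ⟨hα, k, hk, hαk⟩ β ⟨hβ, hβk⟩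
    by_contra hne
    obtain ⟨n, hn⟩ := hR.integral α hα β hβ
    have hn0 : n ≠ 0 := by
      rintro rfl
      rw [pairing, Int.cast_zero, div_eq_zero_iff] at hn
      rcases hn with hn | hn
      · exact hne (by rw [hR.symm]; linarith)
      · exact (hR.psd.pos_of_notMem (mem_nonIso.1 hα).2).ne' hn
    have := add_pairing_smul_mem hR.psd hR.refl_mem (mem_nonIso.1 hβ).1 hα
      ((radical B).smul_of_tower_mem k hsr) hαk hn
    rw [smul_smul] at this
    exact hβk _ (mul_ne_zero hn0 hk) this

theorem isoLattice_le_radical : ∀ l ∈ isoLattice B R, l ∈ radical B := by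
  intro l hl
  have : isoLattice B R ≤ (radical B).toAddSubgroup := by
    rw [isoLattice, AddSubgroup.closure_le]
    exact fun x hx => hx.2
  exact this hl

/-- Translates of `α` along `s` and along `t` combine, after passing to common multiples, by a point
reflection; hence the property extends from `R⁰` to the group it generates. -/
theorem IsEARS.exists_smul_isoLattice (hR : IsEARS B R) (hirr : IsIrreducible B R) {α : V}
    (hα : α ∈ nonIso B R) {l : V} (hl : l ∈ isoLattice B R) :
    ∃ k : ℤ, k ≠ 0 ∧ α + k • l ∈ R := by
  have key : ∀ s ∈ radical B, (∃ k : ℤ, k ≠ 0 ∧ α + k • s ∈ R) →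
      ∃ m : ℤ, m ≠ 0 ∧ ∀ j : ℤ, α + (j * m) • s ∈ R := by
    rintro s hs ⟨k, hk, hαk⟩
    obtain ⟨m, hm, hmj⟩ := exists_level hR.psd hR.refl_mem hα hs hk hαk
    exact ⟨m, by omega, fun j => (hmj _).2 (Dvd.intro_left j rfl)⟩
  induction hl using AddSubgroup.closure_induction with
  | mem s hs => exact hR.exists_smul_iso hirr hs α hα
  | zero => exact ⟨1, one_ne_zero, by simpa using (mem_nonIso.1 hα).1⟩
  | add s t hs ht ihs iht =>
    have hsr := isoLattice_le_radical s hs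
    have htr := isoLattice_le_radical t ht
    obtain ⟨p, hp, hps⟩ := key s hsr ihs
    obtain ⟨q, hq, hqt⟩ := key t htr iht
    -- Reflecting the shift `-2pq t` at `qp s` gives `2pq(s + t)`.
    refine ⟨2 * p * q, by positivity, ?_⟩
    have := add_two_smul_sub_mem hR.psd hR.refl_mem (mem_nonIso.1 hα).2
      ((radical B).smul_of_tower_mem (q * p) hsr) ((radical B).smul_of_tower_mem (-2 * p * q) htr)
      (hps q) (hqt (-2 * p))
    convert this using 2
    module
  | neg s hs ih =>
    obtain ⟨k, hk, h⟩ := ih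
    exact ⟨-k, neg_ne_zero.2 hk, by simpa using h⟩

end EARS

/-! ### Passing between a subset and its span -/

section Induced

variable {V : Type*} [AddCommGroup V] [Module ℝ V] {B : LinearMap.BilinForm ℝ V} {T : Set V}

theorem inducedForm_apply (x y : Submodule.span ℝ T) : inducedForm B T x y = B x y := rfl

theorem IsSymmPSD.inducedForm (hB : IsSymmPSD B) (T : Set V) : IsSymmPSD (inducedForm B T) :=
  ⟨fun v w => hB.symm v w, fun v => hB.nonneg v⟩

theorem IsSymmPSD.mem_radical_inducedForm (hB : IsSymmPSD B) {x : Submodule.span ℝ T} :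
    x ∈ radical (ExtAffine.inducedForm B T) ↔ (x : V) ∈ radical B := by
  rw [(hB.inducedForm T).mem_radical_iff, hB.mem_radical_iff, inducedForm_apply]

theorem IsSymmPSD.mem_nonIso_inSpan (hB : IsSymmPSD B) {x : Submodule.span ℝ T} :
    x ∈ nonIso (ExtAffine.inducedForm B T) (inSpan T) ↔ (x : V) ∈ nonIso B T := by
  rw [mem_nonIso, mem_nonIso, hB.mem_radical_inducedForm]
  rfl

theorem IsSymmPSD.mem_iso_inSpan (hB : IsSymmPSD B) {x : Submodule.span ℝ T} :
    x ∈ iso (ExtAffine.inducedForm B T) (inSpan T) ↔ (x : V) ∈ iso B T := by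
  rw [mem_iso, mem_iso, hB.mem_radical_inducedForm]
  rfl

theorem coe_refl_inducedForm (x y : Submodule.span ℝ T) :
    ((refl (inducedForm B T) x y : Submodule.span ℝ T) : V) = refl B x y := rfl

end Induced

/-! ### Finite subsystems and their levels -/

section FiniteSubsystems

variable {V : Type*} [AddCommGroup V] [Module ℝ V] {B : LinearMap.BilinForm ℝ V} {R T : Set V}

theorem nonIso_mono (h : T ⊆ R) : nonIso B T ⊆ nonIso B R := fun _ hx =>
  mem_nonIso.2 ⟨h (mem_nonIso.1 hx).1, (mem_nonIso.1 hx).2⟩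

theorem IsSubsystem.refl_mem (hB : IsSymmPSD B) (hT : IsSubsystem B R T) :
    ∀ α ∈ nonIso B T, ∀ β ∈ T, refl B α β ∈ T := by
  intro α hα β hβ
  exact hT.2.refl_mem ⟨α, Submodule.subset_span (mem_nonIso.1 hα).1⟩ (hB.mem_nonIso_inSpan.2 hα)
    ⟨β, Submodule.subset_span hβ⟩ hβ

theorem IsSubsystem.nonempty_nonIso (hT : IsSubsystem B R T) :
    (nonIso B T).Nonempty := by
  by_contra hcon
  rw [Set.not_nonempty_iff_eq_empty] at hcon
  refine hT.2.nontrivial ?_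
  have hrad : ∀ x : Submodule.span ℝ T, (x : V) ∈ radical B := by
    rintro ⟨x, hx⟩
    have : Submodule.span ℝ T ≤ radical B := by
      rw [Submodule.span_le]
      intro y hy
      by_contra hy'
      have : y ∈ nonIso B T := mem_nonIso.2 ⟨hy, hy'⟩
      rw [hcon] at this
      exact this
    exact this hx
  ext x y
  exact apply_of_mem_radical (hrad x) _

/-- A finite subsystem embeds in `V / V⁰`. -/
theorem eq_of_sub_mem_radical (hB : IsSymmPSD B)
    (hT : ∀ α ∈ nonIso B T, ∀ β ∈ T, refl B α β ∈ T) (hfin : T.Finite) {α β : V}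
    (hα : α ∈ nonIso B T) (hβ : β ∈ nonIso B T) (h : α - β ∈ radical B) : α = β := by
  by_contra hne
  -- Two distinct roots of `T` congruent modulo the radical would generate, inside `T`, the whole
  -- progression `β + j(α - β)`, contradicting finiteness.
  obtain ⟨m, hm, hmj⟩ := exists_level hB hT hβ h one_ne_zero
    (by simpa using (mem_nonIso.1 hα).1)
  have h1 : (m : ℤ) ∣ 1 := (hmj 1).1 (by simpa using (mem_nonIso.1 hα).1)
  have hinj : Function.Injective fun j : ℤ => β + j • (α - β) := by
    intro i j hij
    have := add_left_cancel hij
    rw [← Int.cast_smul_eq_zsmul ℝ, ← Int.cast_smul_eq_zsmul ℝ] at this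
    exact Int.cast_injective (smul_left_injective ℝ (sub_ne_zero.2 hne) this)
  exact Set.infinite_of_injective_forall_mem hinj
    (fun j => (hmj j).2 (h1.trans (one_dvd j))) hfin

/-- Reducedness is inherited from the image of `R` in `V / V⁰`: proportional roots of `T` agree up
to sign modulo the radical, and finiteness of `T` lifts this to equality up to sign. -/
theorem IsSubsystem.isFinRootSystem (hR : IsEARS B R) (hRred : IsReduced B R)
    (hT : IsSubsystem B R T) (hTfin : T.Finite) (hTirr : IsIrreducibleSub B T) :
    IsFinRootSystem B (nonIso B T) where
  psd := hR.psd
  finite := hTfin.subset fun x hx => (mem_nonIso.1 hx).1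
  nonempty := hT.nonempty_nonIso
  notMem_radical α hα := (mem_nonIso.1 hα).2
  integral α hα β hβ := hR.integral α (nonIso_mono hT.1 hα) β (nonIso_mono hT.1 hβ)
  refl_mem := by
    intro α hα β hβ
    refine mem_nonIso.2 ⟨hT.refl_mem hR.psd α hα β (mem_nonIso.1 hβ).1, ?_⟩
    rw [hR.psd.mem_radical_iff,
      hR.psd.refl_isometry (hR.psd.pos_of_notMem (mem_nonIso.1 hα).2).ne', ← hR.psd.mem_radical_iff]
    exact (mem_nonIso.1 hβ).2
  reduced := by
    intro α hα β hβ c hc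
    have hα' := mem_nonIso.1 hα
    have hβ' := mem_nonIso.1 hβ
    have heq : c • (radical B).mkQ β = (radical B).mkQ α := by
      rw [← map_smul, eq_comm, ← sub_eq_zero, ← map_sub, Submodule.mkQ_apply,
        Submodule.Quotient.mk_eq_zero]
      exact hc
    have hc0 : c ≠ 0 := by
      rintro rfl
      rw [zero_smul, sub_zero] at hc
      exact hα'.2 hc
    have hβ0 : (radical B).mkQ β ≠ 0 := by
      rw [Submodule.mkQ_apply, Ne, Submodule.Quotient.mk_eq_zero]
      exact hβ'.2
    have hinj := fun {x y : V} => eq_of_sub_mem_radical (α := x) (β := y) hR.psd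
      (hT.refl_mem hR.psd) hTfin
    rcases hRred _ ⟨β, hT.1 hβ'.1, rfl⟩ hβ0 c hc0 (heq ▸ ⟨α, hT.1 hα'.1, rfl⟩) with rfl | rfl
    · exact Or.inl (hinj hα hβ (by rwa [one_smul] at hc))
    · exact Or.inr (hinj hα (neg_mem_of_refl_mem hR.psd (hT.refl_mem hR.psd) hβ)
        (by rwa [neg_smul, one_smul] at hc))
  irreducible := by
    intro P Q hP hQ hPQ
    by_contra! hcon
    have hPT : ∀ x ∈ P ∪ Q, x ∈ Submodule.span ℝ T := fun x hx =>
      Submodule.subset_span (mem_nonIso.1 (hPQ ▸ hx)).1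
    refine hTirr ⟨Subtype.val ⁻¹' P, Subtype.val ⁻¹' Q, ?_, ?_, ?_, ?_⟩
    · obtain ⟨x, hx⟩ := hP
      exact ⟨⟨x, hPT x (Or.inl hx)⟩, hx⟩
    · obtain ⟨x, hx⟩ := hQ
      exact ⟨⟨x, hPT x (Or.inr hx)⟩, hx⟩
    · ext x
      rw [hR.psd.mem_nonIso_inSpan, ← hPQ]
      rfl
    · exact fun α hα β hβ => hcon α hα β hβ

/-- The translates of the roots of `T` in the direction `l` are described by a level function. -/
theorem IsSubsystem.exists_isLevel (hR : IsEARS B R) (hRirr : IsIrreducible B R)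
    (hT : IsSubsystem B R T) {l : V} (hl : l ∈ isoLattice B R) :
    ∃ m : V → ℕ, IsLevel B (nonIso B T) m ∧
      ∀ α ∈ nonIso B T, ∀ j : ℤ, α + j • l ∈ R ↔ (m α : ℤ) ∣ j := by
  have hlr := isoLattice_le_radical l hl
  have hex : ∀ α ∈ nonIso B T, ∃ m : ℕ, 0 < m ∧ ∀ j : ℤ, α + j • l ∈ R ↔ (m : ℤ) ∣ j := by
    intro α hα
    obtain ⟨k, hk, hαk⟩ := hR.exists_smul_isoLattice hRirr (nonIso_mono hT.1 hα) hl
    exact exists_level hR.psd hR.refl_mem (nonIso_mono hT.1 hα) hlr hk hαk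
  choose! m hm using hex
  refine ⟨m, ⟨fun α hα => (hm α hα).1, ?_, ?_⟩, fun α hα => (hm α hα).2⟩
  · intro α hα β hβ
    have hα' := nonIso_mono hT.1 hα
    have hαn := (hR.psd.pos_of_notMem (mem_nonIso.1 hα).2).ne'
    have hαβ : refl B α β ∈ nonIso B T := by
      refine mem_nonIso.2 ⟨hT.refl_mem hR.psd α hα β (mem_nonIso.1 hβ).1, ?_⟩
      rw [hR.psd.mem_radical_iff, hR.psd.refl_isometry hαn, ← hR.psd.mem_radical_iff]
      exact (mem_nonIso.1 hβ).2
    -- Reflections fix `l`, so they carry the string through `β` onto the string through its image.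
    have hiff : ∀ j : ℤ, (m (refl B α β) : ℤ) ∣ j ↔ (m β : ℤ) ∣ j := by
      intro j
      have hjl : j • l ∈ radical B := (radical B).smul_of_tower_mem j hlr
      rw [← (hm β hβ).2, ← (hm _ hαβ).2]
      constructor
      · intro h
        have := hR.refl_mem α hα' _ h
        rwa [refl_add, refl_of_mem_radical hjl, refl_refl hαn] at this
      · intro h
        have := hR.refl_mem α hα' _ h
        rwa [refl_add, refl_of_mem_radical hjl] at this
    exact Nat.dvd_antisymm (Int.natCast_dvd_natCast.1 ((hiff _).2 dvd_rfl))
      (Int.natCast_dvd_natCast.1 ((hiff _).1 dvd_rfl))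
  · intro α hα β hβ n hn
    rw [← (hm α hα).2, ← smul_smul]
    exact add_pairing_smul_mem hR.psd hR.refl_mem (hT.1 (mem_nonIso.1 hα).1)
      (nonIso_mono hT.1 hβ) ((radical B).smul_of_tower_mem _ hlr)
      (((hm β hβ).2 _).2 dvd_rfl) hn

end FiniteSubsystems

/-! ### Orbits and lattice bases in the span -/

section Span

variable {V : Type*} [AddCommGroup V] [Module ℝ V] {B : LinearMap.BilinForm ℝ V} {T : Set V}

theorem mem_simpleOrbit_inducedForm {ι : Type*} {a : ι → Submodule.span ℝ T}
    (ha : ∀ i, B (a i) (a i) ≠ 0) {x : Submodule.span ℝ T} :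
    x ∈ simpleOrbit (inducedForm B T) a ↔ (x : V) ∈ simpleOrbit B fun i => (a i : V) := by
  constructor
  · intro hx
    refine simpleOrbit_induction (B := inducedForm B T)
      (p := fun x => (x : V) ∈ simpleOrbit B fun i => (a i : V)) ha
      (fun i => self_mem_simpleOrbit (a := fun i => (a i : V)) i) (fun i v hv => ?_) hx
    rw [coe_refl_inducedForm]
    exact refl_mem_simpleOrbit (a := fun i => (a i : V)) ha i hv
  · intro hx
    obtain ⟨_, h⟩ := simpleOrbit_induction (B := B) (a := fun i => (a i : V))
      (p := fun v => ∃ hv : v ∈ Submodule.span ℝ T,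
        (⟨v, hv⟩ : Submodule.span ℝ T) ∈ simpleOrbit (inducedForm B T) a) ha
      (fun i => ⟨(a i).2, self_mem_simpleOrbit i⟩)
      (fun i v ⟨hv, hv'⟩ => ⟨(refl (inducedForm B T) (a i) ⟨v, hv⟩).2,
        refl_mem_simpleOrbit (B := inducedForm B T) ha i hv'⟩) hx
    exact h

/-- A linearly independent family generating the same group as `T`, as a basis of `span T`. -/
theorem exists_basis_span {n : ℕ} {a : Fin n → V} (hli : LinearIndependent ℝ a)
    (hcl : AddSubgroup.closure T = AddSubgroup.closure (Set.range a)) :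
    ∃ b : Module.Basis (Fin n) ℝ (Submodule.span ℝ T), (∀ i, (b i : V) = a i) ∧
      AddSubgroup.closure (inSpan T) = AddSubgroup.closure (Set.range b) := by
  have hspan : Submodule.span ℝ T = Submodule.span ℝ (Set.range a) := by
    have aux : ∀ S S' : Set V, AddSubgroup.closure S ≤ AddSubgroup.closure S' →
        Submodule.span ℝ S ≤ Submodule.span ℝ S' := by
      intro S S' h
      rw [Submodule.span_le]
      intro x hx
      have h' : AddSubgroup.closure S' ≤ (Submodule.span ℝ S').toAddSubgroup := by
        rw [AddSubgroup.closure_le]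
        exact Submodule.subset_span
      exact h' (h (AddSubgroup.subset_closure hx))
    exact le_antisymm (aux _ _ hcl.le) (aux _ _ hcl.ge)
  have hmem : ∀ i, a i ∈ Submodule.span ℝ T := fun i => by
    rw [hspan]; exact Submodule.subset_span ⟨i, rfl⟩
  let v : Fin n → Submodule.span ℝ T := fun i => ⟨a i, hmem i⟩
  have hrange : Subtype.val '' Set.range v = Set.range a := by
    rw [← Set.range_comp]; rfl
  have hv : LinearIndependent ℝ v :=
    LinearIndependent.of_comp (Submodule.span ℝ T).subtype hli
  have htop : ⊤ ≤ Submodule.span ℝ (Set.range v) := by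
    refine le_of_eq (Submodule.map_injective_of_injective
      (Submodule.span ℝ T).injective_subtype ?_)
    rw [Submodule.map_top, Submodule.range_subtype, Submodule.map_span]
    exact hspan.trans (congrArg _ hrange.symm)
  refine ⟨Module.Basis.mk hv htop, fun i => by rw [Module.Basis.mk_apply], ?_⟩
  rw [Module.Basis.coe_mk]
  refine AddSubgroup.map_injective (f := (Submodule.span ℝ T).subtype.toAddMonoidHom)
    (Submodule.span ℝ T).injective_subtype ?_
  rw [AddMonoidHom.map_closure, AddMonoidHom.map_closure]
  have h1 : (Submodule.span ℝ T).subtype.toAddMonoidHom '' inSpan T = T := by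
    ext x
    constructor
    · rintro ⟨y, hy, rfl⟩
      exact hy
    · exact fun hx => ⟨⟨x, Submodule.subset_span hx⟩, hx, rfl⟩
  have h2 : (Submodule.span ℝ T).subtype.toAddMonoidHom '' Set.range v = Set.range a := hrange
  rw [h1, h2, hcl]

end Span

/-! ### The Cartan matrix of the extended base -/

section CartanData

variable {V : Type*} [AddCommGroup V] [Module ℝ V] {B : LinearMap.BilinForm ℝ V} {F : Set V}
  {n : ℕ} {a : Fin n → V} {θ δ : V}

/-- A dependence would put the isotropic vector `δ` in the span of the base, which meets the radical
only in `0`. -/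
theorem linearIndependent_extended (b : IsBase B F a) (hθ : ∃ c : Fin n → ℝ, θ = ∑ i, c i • a i)
    (hδ : δ ∈ radical B) (hδ0 : δ ≠ 0) :
    LinearIndependent ℝ (Fin.cons (δ - θ) a : Fin (n + 1) → V) := by
  rw [linearIndependent_finCons]
  refine ⟨LinearIndependent.of_comp (radical B).mkQ b.indep, fun hmem => hδ0 ?_⟩
  obtain ⟨c, hc⟩ := hθ
  obtain ⟨d, hd⟩ := (Submodule.mem_span_range_iff_exists_fun ℝ).1 hmem
  have hδeq : δ = ∑ i, (d i + c i) • a i := by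
    simp only [add_smul, Finset.sum_add_distrib, hd, ← hc, sub_add_cancel]
  have h0 := b.coeff_eq_zero (c := fun i => d i + c i) (hδeq ▸ hδ)
  rw [hδeq]
  exact Finset.sum_eq_zero fun i _ => by rw [h0 i, zero_smul]

theorem extended_nonpos (h : IsFinRootSystem B F) (b : IsBase B F a)
    (hdom : ∀ i, 0 ≤ B θ (a i)) (hδ : δ ∈ radical B) (i j : Fin (n + 1)) (hij : i ≠ j) :
    B ((Fin.cons (δ - θ) a : Fin (n + 1) → V) i)
      ((Fin.cons (δ - θ) a : Fin (n + 1) → V) j) ≤ 0 := by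
  have h0 : ∀ i, B (δ - θ) (a i) ≤ 0 := fun i => by
    rw [map_sub, LinearMap.sub_apply, apply_of_mem_radical hδ, zero_sub]
    exact neg_nonpos.2 (hdom i)
  rcases Fin.eq_zero_or_eq_succ i with rfl | ⟨i, rfl⟩ <;>
    rcases Fin.eq_zero_or_eq_succ j with rfl | ⟨j, rfl⟩
  · exact absurd rfl hij
  · simpa only [Fin.cons_zero, Fin.cons_succ] using h0 j
  · simp only [Fin.cons_zero, Fin.cons_succ]
    rw [h.psd.symm]
    exact h0 i
  · simpa only [Fin.cons_succ] using b.nonpos i j fun hh => hij (by rw [hh])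

/-- The base itself is indecomposable, and `δ - θ` is attached to it because `θ` is a combination of
the `a i` and is not orthogonal to itself. -/
theorem extended_indecomposable (h : IsFinRootSystem B F) (b : IsBase B F a) (hθ : θ ∈ F)
    (hθc : ∃ c : Fin n → ℝ, θ = ∑ i, c i • a i) (hδ : δ ∈ radical B) {s : Set (Fin (n + 1))}
    (hs : s.Nonempty) (hs' : sᶜ.Nonempty) : ∃ i ∈ s, ∃ j ∈ sᶜ,
      B ((Fin.cons (δ - θ) a : Fin (n + 1) → V) i)
        ((Fin.cons (δ - θ) a : Fin (n + 1) → V) j) ≠ 0 := by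
  obtain ⟨i₀, hi₀⟩ : ∃ i, B (δ - θ) (a i) ≠ 0 := by
    by_contra! hcon
    obtain ⟨c, hc⟩ := hθc
    have h0 : B (δ - θ) θ = 0 := by
      rw [hc, map_sum, ← hc]
      simp only [map_smul, hcon, smul_zero, Finset.sum_const_zero]
    rw [map_sub, LinearMap.sub_apply, apply_of_mem_radical hδ, zero_sub, neg_eq_zero] at h0
    exact h.norm_ne hθ h0
  by_cases h1 : ∃ i : Fin n, i.succ ∈ s
  · by_cases h2 : ∃ i : Fin n, i.succ ∈ sᶜ
    · obtain ⟨i, hi, j, hj, hij⟩ := b.exists_apply_ne_zero h (s := Fin.succ ⁻¹' s) h1 h2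
      exact ⟨i.succ, hi, j.succ, hj, by simpa only [Fin.cons_succ] using hij⟩
    · push Not at h2
      obtain ⟨k, hk⟩ := hs'
      rcases Fin.eq_zero_or_eq_succ k with rfl | ⟨k, rfl⟩
      · refine ⟨i₀.succ, not_not.1 (h2 i₀), 0, hk, ?_⟩
        rw [Fin.cons_succ, Fin.cons_zero, h.psd.symm]
        exact hi₀
      · exact absurd hk (h2 k)
  · push Not at h1
    obtain ⟨k, hk⟩ := hs
    rcases Fin.eq_zero_or_eq_succ k with rfl | ⟨k, rfl⟩
    · exact ⟨0, hk, i₀.succ, h1 i₀, by simpa only [Fin.cons_succ, Fin.cons_zero] using hi₀⟩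
    · exact absurd hk (h1 k)

end CartanData

/-! ### Recognizing an affine root system -/

section Recognition

variable {V : Type*} [AddCommGroup V] [Module ℝ V] {B : LinearMap.BilinForm ℝ V} {S : Set V}

/-- Recognition of affine root systems among subsets of a space with a semidefinite form. -/
theorem isAffineSub_of_simpleOrbit (hB : IsSymmPSD B) {n : ℕ} {a : Fin n → V}
    (hli : LinearIndependent ℝ a)
    (hcl : AddSubgroup.closure S = AddSubgroup.closure (Set.range a))
    (hnorm : ∀ i, B (a i) (a i) ≠ 0) (hint : ∀ i j, ∃ k : ℤ, pairing B (a j) (a i) = k)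
    (hnonpos : ∀ i j, i ≠ j → B (a i) (a j) ≤ 0)
    (hindec : ∀ s : Set (Fin n), s.Nonempty → sᶜ.Nonempty →
      ∃ i ∈ s, ∃ j ∈ sᶜ, B (a i) (a j) ≠ 0)
    {u : Fin n → ℤ} (hu : ∀ i, 0 < u i) (hu1 : ∃ i, u i = 1) {δ : V} (hδ : δ ∈ radical B)
    (hsum : ∑ i, u i • a i = δ) (hreal : nonIso B S = simpleOrbit B a)
    (himag : iso B S = {s | ∃ k : ℤ, s = k • δ}) : IsAffineSub B S := by
  obtain ⟨b, hb, -⟩ := exists_basis_span hli hcl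
  choose A hA using hint
  have hpos : ∀ i, 0 < B (a i) (a i) := fun i => lt_of_le_of_ne (hB.nonneg _) (hnorm i).symm
  have hA0 : ∀ i j, A i j = 0 ↔ B (a j) (a i) = 0 := by
    intro i j
    rw [← Int.cast_eq_zero (α := ℝ), ← hA, pairing, div_eq_zero_iff, or_iff_left (hnorm i)]
    constructor
    · intro h; linarith
    · intro h; rw [h, mul_zero]
  have hsumb : ((∑ i, u i • b i : Submodule.span ℝ S) : V) = δ := by
    rw [← hsum, AddSubmonoidClass.coe_finsetSum]
    exact Finset.sum_congr rfl fun i _ => by rw [← hb i]; rfl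
  refine ⟨n, b, A, u, fun i => ?_, fun i j => ?_, ⟨fun i => ?_, fun i j hij => ?_, fun i j h => ?_⟩,
    fun s hs hs' => ?_, ⟨hu, ?_, fun d hd => ?_⟩, ?_, ?_⟩
  · rw [inducedForm_apply, hb]; exact hpos i
  · rw [← hA i j, ← hb i, ← hb j]; rfl
  · have := hA i i
    rw [pairing_self (hnorm i)] at this
    exact_mod_cast this.symm
  · have h1 : pairing B (a j) (a i) ≤ 0 :=
      div_nonpos_of_nonpos_of_nonneg (by linarith [hnonpos j i hij.symm]) (hpos i).le
    rw [hA] at h1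
    exact_mod_cast h1
  · rw [hA0] at h ⊢
    rw [hB.symm, h]
  · obtain ⟨i, hi, j, hj, hij⟩ := hindec s hs hs'
    exact ⟨i, hi, j, hj, by rw [Ne, hA0, hB.symm]; exact hij⟩
  · ext i
    -- Row `i` of `A u` is the Cartan number of `∑ u j • a j = δ` against `a i`, which vanishes as
    -- `δ` is isotropic.
    have h1 : ((∑ j, A i j * u j : ℤ) : ℝ) = pairing B (∑ j, u j • a j) (a i) := by
      simp only [pairing, map_sum, LinearMap.sum_apply, Finset.mul_sum, Finset.sum_div,
        Int.cast_sum, Int.cast_mul, ← hA]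
      refine Finset.sum_congr rfl fun j _ => ?_
      rw [← Int.cast_smul_eq_zsmul ℝ, map_smul, LinearMap.smul_apply, smul_eq_mul]
      ring
    rw [hsum, pairing_eq_zero_of_mem_radical hδ] at h1
    exact_mod_cast h1
  · obtain ⟨i, hi⟩ := hu1
    have := hd i
    rw [hi] at this
    exact isUnit_of_dvd_one this
  · ext x
    have hbn : ∀ i, B (b i) (b i) ≠ 0 := fun i => by rw [hb]; exact hnorm i
    rw [hB.mem_nonIso_inSpan, hreal]
    refine Iff.trans ?_ (mem_simpleOrbit_inducedForm hbn).symm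
    simp only [hb]
  · ext x
    rw [hB.mem_iso_inSpan, himag]
    simp only [Set.mem_ofPred_eq, Subtype.ext_iff]
    refine exists_congr fun k => ?_
    rw [← hsumb]
    rfl

end Recognition

/-! ### Subsystem, irreducibility and explicit form of the affinization -/

section Main

variable {V : Type*} [AddCommGroup V] [Module ℝ V] {B : LinearMap.BilinForm ℝ V} {R T : Set V}

/-- A subset of an extended affine root system that is closed under its reflections and under
isotropic differences is a subsystem as soon as it generates a full lattice in its span. -/
theorem IsEARS.isSubsystem (hR : IsEARS B R) {S : Set V} (hSR : S ⊆ R)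
    (hne : (nonIso B S).Nonempty) {n : ℕ} {a : Fin n → V} (hli : LinearIndependent ℝ a)
    (hcl : AddSubgroup.closure S = AddSubgroup.closure (Set.range a))
    (hrefl : ∀ α ∈ nonIso B S, ∀ β ∈ S, refl B α β ∈ S)
    (hiso : iso B S = {s | s ∈ radical B ∧ ∃ α ∈ nonIso B S, ∃ β ∈ nonIso B S, s = α - β}) :
    IsSubsystem B R S := by
  have hB := hR.psd
  refine ⟨hSR, (hB.inducedForm S).symm, (hB.inducedForm S).nonneg, ?_, ?_, ?_, ?_, ?_, ?_⟩
  · intro h0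
    obtain ⟨α, hα⟩ := hne
    have hα' := mem_nonIso.1 hα
    refine (hB.pos_of_notMem hα'.2).ne' ?_
    have hαs : α ∈ Submodule.span ℝ S := Submodule.subset_span hα'.1
    have := congrArg (fun f : LinearMap.BilinForm ℝ _ => f ⟨α, hαs⟩ ⟨α, hαs⟩) h0
    exact this
  · obtain ⟨b, -, hb⟩ := exists_basis_span hli hcl
    exact ⟨n, b, hb⟩
  · intro α hα β hβ
    rw [hB.mem_nonIso_inSpan] at hα hβ
    exact hR.integral α (nonIso_mono hSR hα) β (nonIso_mono hSR hβ)
  · intro α hα β hβ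
    rw [hB.mem_nonIso_inSpan] at hα
    exact hrefl α hα β hβ
  · ext x
    rw [hB.mem_iso_inSpan, hiso]
    simp only [Set.mem_ofPred_eq, hB.mem_radical_inducedForm]
    refine and_congr_right fun _ => ⟨?_, ?_⟩
    · rintro ⟨α, hα, β, hβ, hx⟩
      exact ⟨⟨α, Submodule.subset_span (mem_nonIso.1 hα).1⟩, hB.mem_nonIso_inSpan.2 hα,
        ⟨β, Submodule.subset_span (mem_nonIso.1 hβ).1⟩, hB.mem_nonIso_inSpan.2 hβ,
        Subtype.ext hx⟩
    · rintro ⟨α, hα, β, hβ, hx⟩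
      exact ⟨α, hB.mem_nonIso_inSpan.1 hα, β, hB.mem_nonIso_inSpan.1 hβ, congrArg Subtype.val hx⟩
  · intro α hα hα2
    rw [hB.mem_nonIso_inSpan] at hα
    exact hR.two_smul_notMem α (nonIso_mono hSR hα) (hSR hα2)

/-- A translate of `α ∈ F` is never orthogonal to `α`, so both lie in the same part of an orthogonal
splitting. Each part thus meets `F`, and irreducibility of `F` applies. -/
theorem levelTranslates_isIrreducibleSub {F S : Set V} {m : V → ℕ} {l : V}
    (h : IsFinRootSystem B F) (hl : l ∈ radical B) (hS : nonIso B S = levelTranslates F m l) :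
    IsIrreducibleSub B S := by
  have hFS : ∀ α ∈ F, α ∈ nonIso B S := fun α hα => by
    rw [hS]
    exact ⟨α, hα, 0, dvd_zero _, by rw [zero_smul, add_zero]⟩
  have key : ∀ P Q : Set V, Q.Nonempty → P ∪ Q = nonIso B S → (∀ α ∈ P, ∀ β ∈ Q, B α β = 0) →
      (F ∩ Q).Nonempty := by
    rintro P Q ⟨x, hx⟩ hPQ horth
    obtain ⟨α, hα, k, -, rfl⟩ : x ∈ levelTranslates F m l := hS ▸ hPQ ▸ Or.inr hx
    have hkl : k • l ∈ radical B := (radical B).smul_of_tower_mem k hl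
    rcases (hPQ ▸ hFS α hα : α ∈ P ∪ Q) with hP | hQ
    · have := horth α hP _ hx
      rw [map_add, h.psd.apply_right_of_mem_radical hkl, add_zero] at this
      exact absurd this (h.norm_ne hα)
    · exact ⟨α, hα, hQ⟩
  rintro ⟨P, Q, hP, hQ, hPQ, horth⟩
  have hcoe : (Subtype.val '' P ∪ Subtype.val '' Q : Set V) = nonIso B S := by
    rw [← Set.image_union, hPQ]
    ext x
    constructor
    · rintro ⟨y, hy, rfl⟩
      exact h.psd.mem_nonIso_inSpan.1 hy
    · exact fun hx => ⟨⟨x, Submodule.subset_span (mem_nonIso.1 hx).1⟩,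
        h.psd.mem_nonIso_inSpan.2 hx, rfl⟩
  have horth' : ∀ α ∈ (Subtype.val '' P : Set V), ∀ β ∈ (Subtype.val '' Q : Set V),
      B α β = 0 := by
    rintro _ ⟨x, hx, rfl⟩ _ ⟨y, hy, rfl⟩
    exact horth x hx y hy
  obtain ⟨α, hα, β, hβ, hne⟩ := h.irreducible _ _
    (key _ (Subtype.val '' P) (hP.image _) (by rw [Set.union_comm]; exact hcoe)
      fun x hx y hy => by rw [h.psd.symm]; exact horth' y hy x hx)
    (key _ (Subtype.val '' Q) (hQ.image _) hcoe horth')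
    (by
      rw [← Set.inter_union_distrib_left, hcoe]
      exact Set.inter_eq_left.2 hFS)
  exact hne (horth' α hα.2 β hβ.2)

theorem translates_eq_levelTranslates {m : V → ℕ} {l : V}
    (hm : ∀ α ∈ nonIso B T, ∀ j : ℤ, α + j • l ∈ R ↔ (m α : ℤ) ∣ j) :
    translates B R T l = levelTranslates (nonIso B T) m l := by
  ext x
  constructor
  · rintro ⟨⟨α, hα, k, rfl⟩, hx⟩
    exact ⟨α, hα, k, (hm α hα k).1 hx, rfl⟩
  · rintro ⟨α, hα, k, hk, rfl⟩
    exact ⟨⟨α, hα, k, rfl⟩, (hm α hα k).2 hk⟩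

theorem levelTranslates_subset_nonIso {m : V → ℕ} {l : V} (hT : T ⊆ R) (hl : l ∈ radical B)
    (hm : ∀ α ∈ nonIso B T, ∀ j : ℤ, α + j • l ∈ R ↔ (m α : ℤ) ∣ j) :
    levelTranslates (nonIso B T) m l ⊆ nonIso B R := by
  rintro x ⟨α, hα, k, hk, rfl⟩
  exact mem_nonIso.2 ⟨(hm α hα k).2 hk, add_radical_notMem (mem_nonIso.1 (nonIso_mono hT hα)).2
    ((radical B).smul_of_tower_mem k hl)⟩

/-- Since `T^×` embeds modulo the radical, an isotropic difference of translates comes from a single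
finite root, and its shift is a multiple of `m θ` because `m θ` divides every level. Conversely the
string through `θ` realizes all these multiples. -/
theorem affinization_eq (hR : IsEARS B R) {m : V → ℕ} {l θ : V} (hT : T ⊆ R)
    (hl : l ∈ radical B) (hm : ∀ α ∈ nonIso B T, ∀ j : ℤ, α + j • l ∈ R ↔ (m α : ℤ) ∣ j)
    (hinj : ∀ α ∈ nonIso B T, ∀ β ∈ nonIso B T, α - β ∈ radical B → α = β)
    (hθ : θ ∈ nonIso B T) (hdvd : ∀ α ∈ nonIso B T, (m θ : ℤ) ∣ m α) :
    affinization B R T l =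
      levelTranslates (nonIso B T) m l ∪ {s | ∃ k : ℤ, s = k • (m θ : ℤ) • l} := by
  rw [affinization, translates_eq_levelTranslates hm]
  congr 1
  ext s
  constructor
  · rintro ⟨⟨_, ⟨α, hα, i, hi, rfl⟩, _, ⟨β, hβ, j, hj, rfl⟩, rfl⟩, hs⟩
    have hil : i • l ∈ radical B := (radical B).smul_of_tower_mem i hl
    have hjl : j • l ∈ radical B := (radical B).smul_of_tower_mem j hl
    have hαβ : α = β := hinj α hα β hβ (by
      have := (radical B).sub_mem hs.2 ((radical B).sub_mem hil hjl)
      convert this using 1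
      abel)
    obtain ⟨k, hk⟩ := dvd_sub ((hdvd α hα).trans hi) ((hdvd β hβ).trans hj)
    refine ⟨k, ?_⟩
    rw [hαβ, add_sub_add_left_eq_sub, ← sub_smul, hk, smul_smul, mul_comm]
  · rintro ⟨k, rfl⟩
    have h1 : θ + (k * m θ) • l ∈ levelTranslates (nonIso B T) m l :=
      ⟨θ, hθ, k * m θ, Dvd.intro_left k rfl, rfl⟩
    have h2 : θ ∈ levelTranslates (nonIso B T) m l :=
      ⟨θ, hθ, 0, dvd_zero _, by rw [zero_smul, add_zero]⟩
    have h3 : k • (m θ : ℤ) • l = (θ + (k * m θ) • l) - θ := by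
      rw [add_sub_cancel_left, smul_smul]
    refine ⟨⟨_, h1, _, h2, h3⟩, ?_⟩
    have hsub := levelTranslates_subset_nonIso hT hl hm
    rw [hR.iso_eq]
    exact ⟨(radical B).smul_of_tower_mem k ((radical B).smul_of_tower_mem (m θ : ℤ) hl),
      _, hsub h1, _, hsub h2, h3⟩

end Main

end ExtAffine

/-! ### Assembly of the proposition -/

theorem proposition3p2 {V : Type*} [AddCommGroup V] [Module ℝ V] [FiniteDimensional ℝ V]
    (B : LinearMap.BilinForm ℝ V) (R : Set V)
    (hR : ExtAffine.IsEARS B R) (hRirr : ExtAffine.IsIrreducible B R)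
    (hRred : ExtAffine.IsReduced B R)
    (T : Set V) (hT : ExtAffine.IsSubsystem B R T) (hTfin : T.Finite)
    (hTirr : ExtAffine.IsIrreducibleSub B T)
    (l : V) (hl : l ∈ ExtAffine.isoLattice B R) (hl0 : l ≠ 0) :
    ExtAffine.IsSubsystem B R (ExtAffine.affinization B R T l) ∧
      ExtAffine.IsIrreducibleSub B (ExtAffine.affinization B R T l) ∧
      ExtAffine.IsAffineSub B (ExtAffine.affinization B R T l) := by
  open ExtAffine in
  have hB := hR.psd
  have h := hT.isFinRootSystem hR hRred hTfin hTirr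
  have hlr := isoLattice_le_radical l hl
  obtain ⟨n, a, b⟩ := h.exists_base
  obtain ⟨m, hm, hmR⟩ := hT.exists_isLevel hR hRirr hl
  obtain ⟨θ, hθ, hdom, ⟨c, hc, hθc⟩, hmin, hmax⟩ := exists_dominant_minimal_level h b hm
  have hdvd : ∀ α ∈ nonIso B T, (m θ : ℤ) ∣ m α := fun α hα =>
    minimal_level_dvd h b hm hθ hmin hmax hα
  have horbit := simpleOrbit_extended_eq h b hm hθ hmin hmax hlr
  have hsub := levelTranslates_subset_nonIso hT.1 hlr hmR
  have hS := affinization_eq hR hT.1 hlr hmR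
    (fun α hα β hβ => eq_of_sub_mem_radical hB (hT.refl_mem hB) hTfin hα hβ) hθ hdvd
  set S := affinization B R T l
  obtain ⟨δ, hδ⟩ : ∃ δ, (m θ : ℤ) • l = δ := ⟨_, rfl⟩
  rw [hδ] at horbit hS
  have hδr : δ ∈ radical B := hδ ▸ (radical B).smul_of_tower_mem (m θ : ℤ) hlr
  have hδ0 : δ ≠ 0 := by
    rw [← hδ, ← Int.cast_smul_eq_zsmul ℝ]
    exact smul_ne_zero (by exact_mod_cast (hm.pos θ hθ).ne') hl0
  have hkδ : ∀ k : ℤ, k • δ ∈ radical B := fun k => (radical B).smul_of_tower_mem k hδr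
  have hreal : nonIso B S = levelTranslates (nonIso B T) m l := by
    ext x
    rw [mem_nonIso, hS]
    constructor
    · rintro ⟨hx | ⟨k, rfl⟩, hx'⟩
      · exact hx
      · exact absurd (hkδ k) hx'
    · exact fun hx => ⟨Or.inl hx, (mem_nonIso.1 (hsub hx)).2⟩
  have himag : iso B S = {s | ∃ k : ℤ, s = k • δ} := by
    ext x
    rw [mem_iso, hS]
    constructor
    · rintro ⟨hx | hx, hx'⟩
      · exact absurd hx' (mem_nonIso.1 (hsub hx)).2
      · exact hx
    · rintro ⟨k, rfl⟩
      exact ⟨Or.inr ⟨k, rfl⟩, hkδ k⟩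
  have hFmem : ∀ α ∈ nonIso B T, α ∈ levelTranslates (nonIso B T) m l := fun α hα =>
    ⟨α, hα, 0, dvd_zero _, by rw [zero_smul, add_zero]⟩
  have htrans : ∀ k : ℤ, θ + k • δ ∈ levelTranslates (nonIso B T) m l := fun k =>
    ⟨θ, hθ, k * m θ, Dvd.intro_left k rfl, by rw [← hδ, smul_smul]⟩
  have hSR : S ⊆ R := by
    intro x hx
    rw [hS] at hx
    rcases hx with hx | ⟨k, rfl⟩
    · exact (mem_nonIso.1 (hsub hx)).1
    · have : k • δ ∈ iso B R := by
        rw [hR.iso_eq]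
        exact ⟨hkδ k, _, hsub (htrans k), _, hsub (hFmem θ hθ), by abel⟩
      exact this.1
  have hθc' : ∃ c : Fin n → ℝ, θ = ∑ i, c i • a i := ⟨_, hθc⟩
  have hli := linearIndependent_extended b hθc' hδr hδ0
  have hnorm := norm_extended_ne h b hθ hδr
  -- This supplies the lattice axiom: `θ` is an integral combination of the `a i`, so the extended
  -- base generates `δ`, and every translate is a finite root plus a multiple of `δ`.
  have hcl : AddSubgroup.closure S =
      AddSubgroup.closure (Set.range (Fin.cons (δ - θ) a : Fin (n + 1) → V)) := by
    refine le_antisymm ?_ ?_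
    · rw [AddSubgroup.closure_le]
      set C := AddSubgroup.closure (Set.range (Fin.cons (δ - θ) a : Fin (n + 1) → V))
      have haC : ∀ i, a i ∈ C := fun i =>
        AddSubgroup.subset_closure ⟨i.succ, by rw [Fin.cons_succ]⟩
      have hFC : ∀ α ∈ nonIso B T, α ∈ C := by
        intro α hα
        rcases b.combo α hα with ⟨d, hd⟩ | ⟨d, hd⟩
        · rw [hd]
          exact C.sum_mem fun i _ => C.nsmul_mem (haC i) _
        · rw [← neg_neg α, hd]
          exact C.neg_mem (C.sum_mem fun i _ => C.nsmul_mem (haC i) _)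
      have hδC : δ ∈ C := by
        have h0 : δ - θ ∈ C := AddSubgroup.subset_closure ⟨0, by rw [Fin.cons_zero]⟩
        simpa using C.add_mem h0 (hFC θ hθ)
      intro x hx
      rw [hS] at hx
      rcases hx with ⟨α, hα, k, hk, rfl⟩ | ⟨k, rfl⟩
      · obtain ⟨j, rfl⟩ := (hdvd α hα).trans hk
        refine C.add_mem (hFC α hα) ?_
        rw [mul_comm, ← smul_smul, hδ]
        exact C.zsmul_mem hδC j
      · exact C.zsmul_mem hδC k
    · rw [AddSubgroup.closure_le]
      rintro _ ⟨i, rfl⟩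
      refine AddSubgroup.subset_closure ?_
      rw [hS, ← horbit]
      exact Or.inl (self_mem_simpleOrbit i)
  refine ⟨hR.isSubsystem hSR ⟨θ, hreal ▸ hFmem θ hθ⟩ hli hcl ?_ ?_,
    levelTranslates_isIrreducibleSub h hlr hreal,
    isAffineSub_of_simpleOrbit hB hli hcl hnorm ?_ (extended_nonpos h b hdom hδr)
      (fun s => extended_indecomposable h b hθ hθc' hδr) (u := Fin.cons 1 fun i => (c i : ℤ))
      ?_ ⟨0, rfl⟩ hδr ?_ (hreal.trans horbit.symm) himag⟩
  · intro α hα β hβ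
    rw [hreal, ← horbit] at hα
    rw [hS] at hβ ⊢
    rcases hβ with hβ | ⟨k, rfl⟩
    · left
      rw [← horbit] at hβ ⊢
      obtain ⟨g, hg, hgα⟩ := hB.exists_weylGroup_eq_refl hnorm hα
      rw [← hgα]
      exact apply_mem_simpleOrbit hg hβ
    · rw [refl_of_mem_radical (hkδ k)]
      exact Or.inr ⟨k, rfl⟩
  · rw [himag, hreal]
    ext x
    constructor
    · rintro ⟨k, rfl⟩
      exact ⟨hkδ k, _, htrans k, θ, hFmem θ hθ, by abel⟩
    · rintro ⟨hx, α, hα, β, hβ, hxeq⟩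
      have : x ∈ iso B S := by
        rw [mem_iso]
        refine ⟨?_, hx⟩
        rw [show S = _ ∪ _ from rfl, translates_eq_levelTranslates hmR]
        refine Or.inr ⟨⟨α, hα, β, hβ, hxeq⟩, ?_⟩
        rw [hR.iso_eq]
        exact ⟨hx, α, hsub hα, β, hsub hβ, hxeq⟩
      rw [himag] at this
      exact this
  · intro i j
    have hmem : ∀ i, (Fin.cons (δ - θ) a : Fin (n + 1) → V) i ∈ nonIso B R := fun i =>
      hsub (horbit ▸ self_mem_simpleOrbit i)
    exact hR.integral _ (hmem i) _ (hmem j)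
  · intro i
    rcases Fin.eq_zero_or_eq_succ i with rfl | ⟨i, rfl⟩
    · exact one_pos
    · rw [Fin.cons_succ]
      exact_mod_cast hc i
  -- With mark `1` on `δ - θ` and marks `c i` on the `a i`, the sum is `(δ - θ) + θ = δ`.
  · rw [Fin.sum_univ_succ]
    simp only [Fin.cons_zero, Fin.cons_succ, one_smul]
    rw [hθc]
    simp [Nat.cast_smul_eq_nsmul]
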